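/- Let $(M,J,g)$ be an almost Norden manifold: $M$ is a smooth finite-dimensional manifold, $g$ a pseudo-Riemannian metric on $M$ and $J$ an almost complex structure with $g(Jx,Jy)=-g(x,y)$. Let $\nabla$ be the Levi-Civita connection of $g$, with curvature $R(X,Y)Z=\nabla_X\nabla_YZ-\nabla_Y\nabla_XZ-\nabla_{[X,Y]}Z$ and $R(X,Y,Z,W)=g(R(X,Y)Z,W)$, and let $F(X,Y,Z)=g((\nabla_XJ)Y,Z)$. Let $X^H$ and $X^V$ denote the horizontal (with respect to $\nabla$) and vertical lifts to the tangent bundle $TM$ of a vector field $X$ on $M$. On $TM$ consider the tensor fields $J_1,J_2,J_3$ and the metric $\hat g$ (the complete lift of $g$) determined by $$J_1X^H=-(JX)^H,\quad J_1X^V=(JX)^V,\qquad J_2X^H=X^V,\quad J_2X^V=-X^H,\qquad J_3X^H=(JX)^V,\quad J_3X^V=(JX)^H,$$ $$\hat g(X^H,Y^H)=\hat g(X^V,Y^V)=0,\qquad \hat g(X^H,Y^V)=\hat g(X^V,Y^H)=g(X,Y).$$ Let $\hat\nabla$ be the Levi-Civita connection of $\hat g$ and, for $\alpha=1,2,3$,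 let $F_\alpha(\hat X,\hat Y,\hat Z)=\hat g((\hat\nabla_{\hat X}J_\alpha)\hat Y,\hat Z)$. Then for all smooth vector fields $X,Y,Z$ on $M$, at every $u\in T_pM\subset TM$ (the right-hand sides being evaluated at $p$), $$F_1(X^H,Y^H,Z^H)=-R(u,X,JY,Z)-R(u,X,Y,JZ),$$ $$F_1(X^H,Y^H,Z^V)=-F_1(X^H,Y^V,Z^H)=-F(X,Y,Z);$$ $$F_2(X^H,Y^H,Z^V)=-F_2(X^H,Y^V,Z^H)=R(u,X,Y,Z);$$ $$F_3(X^H,Y^H,Z^H)=F_3(X^H,Y^V,Z^V)=F(X,Y,Z),$$ $$F_3(X^H,Y^H,Z^V)=-R(u,X,Y,JZ),\qquad F_3(X^H,Y^V,Z^H)=R(u,X,JY,Z),$$ and all other components of $F_1,F_2,F_3$ on triples of horizontal and vertical lifts vanish; that is, $F_1(X^H,Y^V,Z^V)=F_2(X^H,Y^H,Z^H)=F_2(X^H,Y^V,Z^V)=0$, and $F_\alpha(X^V,\cdot,\cdot)=0$ on all pairs of lifts for $\alpha=1,2,3$. -/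

import Mathlib

open Bundle
open scoped Manifold ContDiff

noncomputable section

/-! ### Levi-Civita connection, curvature and structure tensors on an arbitrary manifold -/

section General

variable {E : Type*} [NormedAddCommGroup E] [NormedSpace ℝ E]
  {H : Type*} [TopologicalSpace H] {I : ModelWithCorners ℝ E H}
  {M : Type*} [TopologicalSpace M] [ChartedSpace H M] [IsManifold I 1 M]

/-- `cov` (where `cov Y x (X x)` is `(∇_X Y)(x)`) is the Levi-Civita connection of the
pseudo-Riemannian metric `g`: a smooth affine connection that is torsion free and satisfies
`X g(Y, Z) = g(∇_X Y, Z) + g(Y, ∇_X Z)`. -/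
structure IsLeviCivita
    (g : Π x : M, TangentSpace I x →L[ℝ] TangentSpace I x →L[ℝ] ℝ)
    (cov : CovariantDerivative I E (TangentSpace I : M → Type _)) : Prop where
  smooth : ∀ (X Y : Π x : M, TangentSpace I x) (x : M),
    CMDiffAt ∞ (T% X) x → CMDiffAt ∞ (T% Y) x → CMDiffAt ∞ (T% (fun y ↦ cov Y y (X y))) x
  torsion_free : ∀ (X Y : Π x : M, TangentSpace I x) (x : M),
    MDiffAt (T% X) x → MDiffAt (T% Y) x →
      cov Y x (X x) - cov X x (Y x) = VectorField.mlieBracket I X Y x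
  metric : ∀ (X Y Z : Π x : M, TangentSpace I x) (x : M),
    MDiffAt (T% Y) x → MDiffAt (T% Z) x →
      d% (fun y ↦ g y (Y y) (Z y)) x (X x)
        = g x (cov Y x (X x)) (Z x) + g x (Y x) (cov Z x (X x))

/-- `R(X, Y)Z = ∇_X ∇_Y Z - ∇_Y ∇_X Z - ∇_[X, Y] Z`. -/
def curvatureOp (cov : CovariantDerivative I E (TangentSpace I : M → Type _))
    (X Y Z : Π x : M, TangentSpace I x) (x : M) : TangentSpace I x :=
  cov (fun y ↦ cov Z y (Y y)) x (X x) - cov (fun y ↦ cov Z y (X y)) x (Y x)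
    - cov Z x (VectorField.mlieBracket I X Y x)

/-- The curvature tensor of type `(0, 4)`, `R(X, Y, Z, W) = g(R(X, Y)Z, W)`. -/
def curvatureForm (g : Π x : M, TangentSpace I x →L[ℝ] TangentSpace I x →L[ℝ] ℝ)
    (cov : CovariantDerivative I E (TangentSpace I : M → Type _))
    (X Y Z W : Π x : M, TangentSpace I x) (x : M) : ℝ :=
  g x (curvatureOp cov X Y Z x) (W x)

/-- The structure tensor `F(X, Y, Z) = g((∇_X J)Y, Z)` of a field of endomorphisms `J`, where
`(∇_X J)Y = ∇_X (JY) - J(∇_X Y)`. -/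
def structureTensor (g : Π x : M, TangentSpace I x →L[ℝ] TangentSpace I x →L[ℝ] ℝ)
    (cov : CovariantDerivative I E (TangentSpace I : M → Type _))
    (J : Π x : M, TangentSpace I x →L[ℝ] TangentSpace I x)
    (X Y Z : Π x : M, TangentSpace I x) (x : M) : ℝ :=
  g x (cov (fun y ↦ J y (Y y)) x (X x) - J x (cov Y x (X x))) (Z x)

end General

section TangentBundleLifts

variable {E : Type*} [NormedAddCommGroup E] [NormedSpace ℝ E]
  {M : Type*} [TopologicalSpace M] [ChartedSpace E M] [IsManifold 𝓘(ℝ, E) ∞ M]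

variable (E M) in
/-- An almost Norden structure `(J, g)` on `M`: a pseudo-Riemannian metric `g` and an almost complex
structure `J` which is an anti-isometry of `g` (so `g` is automatically of neutral signature). -/
structure AlmostNordenStructure where
  g : Π x : M, TangentSpace 𝓘(ℝ, E) x →L[ℝ] TangentSpace 𝓘(ℝ, E) x →L[ℝ] ℝ
  g_symm : ∀ (x : M) (v w : TangentSpace 𝓘(ℝ, E) x), g x v w = g x w v
  g_nondegenerate : ∀ (x : M) (v : TangentSpace 𝓘(ℝ, E) x), (∀ w, g x v w = 0) → v = 0
  g_smooth : ContMDiff 𝓘(ℝ, E) (𝓘(ℝ, E).prod 𝓘(ℝ, E →L[ℝ] E →L[ℝ] ℝ)) ∞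
    (fun x : M ↦ TotalSpace.mk' (E →L[ℝ] E →L[ℝ] ℝ)
      (E := fun x : M ↦ TangentSpace 𝓘(ℝ, E) x →L[ℝ] TangentSpace 𝓘(ℝ, E) x →L[ℝ] ℝ) x (g x))
  J : Π x : M, TangentSpace 𝓘(ℝ, E) x →L[ℝ] TangentSpace 𝓘(ℝ, E) x
  J_smooth : ContMDiff 𝓘(ℝ, E) (𝓘(ℝ, E).prod 𝓘(ℝ, E →L[ℝ] E)) ∞
    (fun x : M ↦ TotalSpace.mk' (E →L[ℝ] E)
      (E := fun x : M ↦ TangentSpace 𝓘(ℝ, E) x →L[ℝ] TangentSpace 𝓘(ℝ, E) x) x (J x))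
  J_sq : ∀ (x : M) (v : TangentSpace 𝓘(ℝ, E) x), J x (J x v) = -v
  norden : ∀ (x : M) (v w : TangentSpace 𝓘(ℝ, E) x), g x (J x v) (J x w) = -g x v w

/-- The vertical lift `T_p M → T_u (TM)`, `p = π u`: the derivative at `u` of the inclusion of the
fibre `T_p M` into `TM`. -/
def vLift (u : TangentBundle 𝓘(ℝ, E) M) :
    TangentSpace 𝓘(ℝ, E) u.1 →L[ℝ] TangentSpace 𝓘(ℝ, E).tangent u :=
  (mfderiv 𝓘(ℝ, E) 𝓘(ℝ, E).tangent
    (fun v : E ↦ (⟨u.1, v⟩ : TangentBundle 𝓘(ℝ, E) M)) u.2 : E →L[ℝ] E × E)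

/-- The derivative at `p = π u` of a local vector field `s` on `M` with `s(p) = u`. -/
def extendDeriv (u : TangentBundle 𝓘(ℝ, E) M) :
    TangentSpace 𝓘(ℝ, E) u.1 →L[ℝ] TangentSpace 𝓘(ℝ, E).tangent u :=
  (mfderiv 𝓘(ℝ, E) 𝓘(ℝ, E).tangent
    (fun q : M ↦ (⟨q, FiberBundle.extend E u.2 q⟩ : TangentBundle 𝓘(ℝ, E) M)) u.1 :
      E →L[ℝ] E × E)

/-- The horizontal lift `T_p M → T_u (TM)`, `p = π u`, with respect to `∇`:
`x^H = ds(x) - (∇_x s)^V` for a local vector field `s` on `M` with `s(p) = u`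
(the choice of `s` does not matter). -/
def hLift (nabla : CovariantDerivative 𝓘(ℝ, E) E (TangentSpace 𝓘(ℝ, E) : M → Type _))
    (u : TangentBundle 𝓘(ℝ, E) M) :
    TangentSpace 𝓘(ℝ, E) u.1 →L[ℝ] TangentSpace 𝓘(ℝ, E).tangent u :=
  extendDeriv u - (vLift u).comp (nabla (FiberBundle.extend E u.2) u.1)

/-- The differential of the projection `π : TM → M` at `u`. -/
def dProj (u : TangentBundle 𝓘(ℝ, E) M) :
    TangentSpace 𝓘(ℝ, E).tangent u →L[ℝ] TangentSpace 𝓘(ℝ, E) u.1 :=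
  mfderiv 𝓘(ℝ, E).tangent 𝓘(ℝ, E) (fun w : TangentBundle 𝓘(ℝ, E) M ↦ w.1) u

theorem fiber_trivialization (p : M) (v : E) :
    (trivializationAt E (TangentSpace 𝓘(ℝ, E)) p (⟨p, v⟩ : TangentBundle 𝓘(ℝ, E) M)).2 = v :=
  tangentCoordChange_self (I := 𝓘(ℝ, E)) (mem_extChartAt_source (I := 𝓘(ℝ, E)) p)

theorem mdifferentiableAt_fiber (p : M) (v : E) :
    MDifferentiableAt 𝓘(ℝ, E) 𝓘(ℝ, E).tangent
      (fun v : E ↦ (⟨p, v⟩ : TangentBundle 𝓘(ℝ, E) M)) v := by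
  refine (mdifferentiableAt_totalSpace 𝓘(ℝ, E) _).2
    ⟨mdifferentiableAt_const, ?_⟩
  have h : (fun v : E ↦ (trivializationAt E (TangentSpace 𝓘(ℝ, E)) p
      (⟨p, v⟩ : TangentBundle 𝓘(ℝ, E) M)).2) = id := funext (fiber_trivialization p)
  have h2 : MDifferentiableAt 𝓘(ℝ, E) 𝓘(ℝ, E) (fun v : E ↦
      (trivializationAt E (TangentSpace 𝓘(ℝ, E)) p
      (⟨p, v⟩ : TangentBundle 𝓘(ℝ, E) M)).2) v := by
    rw [h]; exact mdifferentiableAt_id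
  exact h2

theorem dProj_vLift (u : TangentBundle 𝓘(ℝ, E) M) (w : TangentSpace 𝓘(ℝ, E) u.1) :
    dProj u (vLift u w) = 0 := by
  obtain ⟨p, (v : E)⟩ := u
  have h1 : HasMFDerivAt 𝓘(ℝ, E).tangent 𝓘(ℝ, E) (fun w : TangentBundle 𝓘(ℝ, E) M ↦ w.1)
      (⟨p, v⟩ : TangentBundle 𝓘(ℝ, E) M) (dProj ⟨p, v⟩) :=
    (mdifferentiableAt_proj (TangentSpace 𝓘(ℝ, E))).hasMFDerivAt
  have h := h1.comp v (f := fun v : E ↦ (⟨p, v⟩ : TangentBundle 𝓘(ℝ, E) M))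
    (mdifferentiableAt_fiber p v).hasMFDerivAt
  have h0 := hasMFDerivAt_unique h
    (hasMFDerivAt_const (I := 𝓘(ℝ, E)) (I' := 𝓘(ℝ, E)) (M := E) p (v : E))
  exact DFunLike.congr_fun h0 w

theorem dProj_extendDeriv (u : TangentBundle 𝓘(ℝ, E) M) (x : TangentSpace 𝓘(ℝ, E) u.1) :
    dProj u (extendDeriv u x) = x := by
  obtain ⟨p, v⟩ := u
  have hs : FiberBundle.extend E v p = v := FiberBundle.extend_apply_self E v
  have h1 : HasMFDerivAt 𝓘(ℝ, E).tangent 𝓘(ℝ, E) (fun w : TangentBundle 𝓘(ℝ, E) M ↦ w.1)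
      (⟨p, FiberBundle.extend E v p⟩ : TangentBundle 𝓘(ℝ, E) M) (dProj ⟨p, v⟩) := by
    rw [hs]
    exact (mdifferentiableAt_proj (TangentSpace 𝓘(ℝ, E))).hasMFDerivAt
  have h := h1.comp p
    (f := fun q : M ↦ (⟨q, FiberBundle.extend E v q⟩ : TangentBundle 𝓘(ℝ, E) M))
    (FiberBundle.mdifferentiableAt_extend 𝓘(ℝ, E) E v).hasMFDerivAt
  have h0 := hasMFDerivAt_unique h (hasMFDerivAt_id p)
  exact DFunLike.congr_fun h0 x

theorem mdifferentiableAt_retraction (p : M) (v : E) :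
    MDifferentiableAt 𝓘(ℝ, E).tangent 𝓘(ℝ, E) (fun w : TangentBundle 𝓘(ℝ, E) M ↦
      (trivializationAt E (TangentSpace 𝓘(ℝ, E)) p w).2) ⟨p, v⟩ := by
  have h := (mdifferentiableAt_totalSpace 𝓘(ℝ, E) (x₀ := (⟨p, v⟩ : TangentBundle 𝓘(ℝ, E) M))
    (fun w : TangentBundle 𝓘(ℝ, E) M ↦ w)).1 mdifferentiableAt_id
  exact h.2

theorem hasMFDerivAt_retraction_fiber (p : M) (v : E) :
    HasMFDerivAt 𝓘(ℝ, E) 𝓘(ℝ, E)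
      ((fun w : TangentBundle 𝓘(ℝ, E) M ↦ (trivializationAt E (TangentSpace 𝓘(ℝ, E)) p w).2) ∘
        fun v : E ↦ (⟨p, v⟩ : TangentBundle 𝓘(ℝ, E) M)) v (ContinuousLinearMap.id ℝ E) := by
  have h : ((fun w : TangentBundle 𝓘(ℝ, E) M ↦
      (trivializationAt E (TangentSpace 𝓘(ℝ, E)) p w).2) ∘
        fun v : E ↦ (⟨p, v⟩ : TangentBundle 𝓘(ℝ, E) M)) = id := funext (fiber_trivialization p)
  rw [h]
  exact hasMFDerivAt_id v

theorem exists_vLift_leftInverse (p : M) (v : E) :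
    ∃ A : TangentSpace 𝓘(ℝ, E).tangent (⟨p, v⟩ : TangentBundle 𝓘(ℝ, E) M) →L[ℝ] E,
      ∀ w : E, A (vLift ⟨p, v⟩ w) = w := by
  have h := (mdifferentiableAt_retraction p v).hasMFDerivAt.comp v
    (mdifferentiableAt_fiber p v).hasMFDerivAt
  have h0 := hasMFDerivAt_unique h (hasMFDerivAt_retraction_fiber p v)
  exact ⟨_, fun w ↦ DFunLike.congr_fun h0 w⟩

theorem vLift_injective (u : TangentBundle 𝓘(ℝ, E) M) : Function.Injective (vLift u) := by
  obtain ⟨A, hA⟩ := exists_vLift_leftInverse (E := E) u.1 u.2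
  intro w w' h
  exact (hA w).symm.trans ((congrArg A h).trans (hA w'))

theorem dProj_hLift (nabla : CovariantDerivative 𝓘(ℝ, E) E (TangentSpace 𝓘(ℝ, E) : M → Type _))
    (u : TangentBundle 𝓘(ℝ, E) M) (x : TangentSpace 𝓘(ℝ, E) u.1) :
    dProj u (hLift nabla u x) = x := by
  change dProj u (extendDeriv u x - vLift u (nabla (FiberBundle.extend E u.2) u.1 x)) = x
  rw [map_sub, dProj_extendDeriv, dProj_vLift, sub_zero]

theorem lift_bijective [FiniteDimensional ℝ E]
    (nabla : CovariantDerivative 𝓘(ℝ, E) E (TangentSpace 𝓘(ℝ, E) : M → Type _))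
    (u : TangentBundle 𝓘(ℝ, E) M) :
    Function.Bijective ((hLift nabla u).coprod (vLift u)) := by
  have hinj : Function.Injective ((hLift nabla u).coprod (vLift u)) := by
    rw [injective_iff_map_eq_zero]
    rintro ⟨x, w⟩ h
    rw [ContinuousLinearMap.coprod_apply] at h
    have hx : x = 0 := by
      have := congrArg (dProj u) h
      rwa [map_add, dProj_hLift, dProj_vLift, add_zero, map_zero] at this
    subst hx
    rw [map_zero, zero_add] at h
    have hw : w = 0 := vLift_injective u (h.trans (map_zero _).symm)
    rw [hw]; rfl
  have : FiniteDimensional ℝ (TangentSpace 𝓘(ℝ, E) u.1) := inferInstanceAs (FiniteDimensional ℝ E)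
  have : FiniteDimensional ℝ (TangentSpace 𝓘(ℝ, E).tangent u) :=
    inferInstanceAs (FiniteDimensional ℝ (E × E))
  refine ⟨hinj, (LinearMap.injective_iff_surjective_of_finrank_eq_finrank
    (f := ((hLift nabla u).coprod (vLift u)).toLinearMap) ?_).1 hinj⟩
  rfl

/-- The splitting `T_p M × T_p M ≃ T_u (TM)`, `(x, w) ↦ x^H + w^V`, `p = π u`, of the tangent space
of `TM` into its horizontal and vertical subspaces. -/
def liftEquiv [FiniteDimensional ℝ E]
    (nabla : CovariantDerivative 𝓘(ℝ, E) E (TangentSpace 𝓘(ℝ, E) : M → Type _))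
    (u : TangentBundle 𝓘(ℝ, E) M) :
    (TangentSpace 𝓘(ℝ, E) u.1 × TangentSpace 𝓘(ℝ, E) u.1) ≃L[ℝ]
      TangentSpace 𝓘(ℝ, E).tangent u :=
  haveI : FiniteDimensional ℝ (TangentSpace 𝓘(ℝ, E) u.1) := inferInstanceAs (FiniteDimensional ℝ E)
  haveI : T2Space (TangentSpace 𝓘(ℝ, E) u.1) := inferInstanceAs (T2Space E)
  haveI : T2Space (TangentSpace 𝓘(ℝ, E).tangent u) := inferInstanceAs (T2Space (E × E))
  (LinearEquiv.ofBijective ((hLift nabla u).coprod (vLift u)).toLinearMap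
    (lift_bijective nabla u)).toContinuousLinearEquiv

@[simp] theorem liftEquiv_symm_hLift [FiniteDimensional ℝ E]
    (nabla : CovariantDerivative 𝓘(ℝ, E) E (TangentSpace 𝓘(ℝ, E) : M → Type _))
    (u : TangentBundle 𝓘(ℝ, E) M) (x : TangentSpace 𝓘(ℝ, E) u.1) :
    (liftEquiv nabla u).symm (hLift nabla u x) = (x, 0) := by
  rw [ContinuousLinearEquiv.symm_apply_eq]
  change _ = hLift nabla u x + vLift u 0
  rw [map_zero, add_zero]

@[simp] theorem liftEquiv_symm_vLift [FiniteDimensional ℝ E]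
    (nabla : CovariantDerivative 𝓘(ℝ, E) E (TangentSpace 𝓘(ℝ, E) : M → Type _))
    (u : TangentBundle 𝓘(ℝ, E) M) (x : TangentSpace 𝓘(ℝ, E) u.1) :
    (liftEquiv nabla u).symm (vLift u x) = (0, x) := by
  rw [ContinuousLinearEquiv.symm_apply_eq]
  change _ = hLift nabla u 0 + vLift u x
  rw [map_zero, zero_add]

/-- The horizontal component `x` of `x^H + w^V`. -/
def hPart [FiniteDimensional ℝ E]
    (nabla : CovariantDerivative 𝓘(ℝ, E) E (TangentSpace 𝓘(ℝ, E) : M → Type _))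
    (u : TangentBundle 𝓘(ℝ, E) M) :
    TangentSpace 𝓘(ℝ, E).tangent u →L[ℝ] TangentSpace 𝓘(ℝ, E) u.1 :=
  (ContinuousLinearMap.fst ℝ _ _).comp (liftEquiv nabla u).symm.toContinuousLinearMap

/-- The vertical component `w` of `x^H + w^V`. -/
def vPart [FiniteDimensional ℝ E]
    (nabla : CovariantDerivative 𝓘(ℝ, E) E (TangentSpace 𝓘(ℝ, E) : M → Type _))
    (u : TangentBundle 𝓘(ℝ, E) M) :
    TangentSpace 𝓘(ℝ, E).tangent u →L[ℝ] TangentSpace 𝓘(ℝ, E) u.1 :=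
  (ContinuousLinearMap.snd ℝ _ _).comp (liftEquiv nabla u).symm.toContinuousLinearMap

/-- The complete lift `ĝ` of `g`: `ĝ(x^H, y^H) = ĝ(x^V, y^V) = 0` and
`ĝ(x^H, y^V) = ĝ(x^V, y^H) = g(x, y)`. -/
def completeLift [FiniteDimensional ℝ E]
    (g : Π x : M, TangentSpace 𝓘(ℝ, E) x →L[ℝ] TangentSpace 𝓘(ℝ, E) x →L[ℝ] ℝ)
    (nabla : CovariantDerivative 𝓘(ℝ, E) E (TangentSpace 𝓘(ℝ, E) : M → Type _))
    (u : TangentBundle 𝓘(ℝ, E) M) :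
    TangentSpace 𝓘(ℝ, E).tangent u →L[ℝ] TangentSpace 𝓘(ℝ, E).tangent u →L[ℝ] ℝ :=
  ((vPart nabla u).precomp ℝ).comp ((g u.1).comp (hPart nabla u))
    + ((hPart nabla u).precomp ℝ).comp ((g u.1).comp (vPart nabla u))

/-- `J₁ : x^H ↦ -(Jx)^H, x^V ↦ (Jx)^V`. -/
def J1 [FiniteDimensional ℝ E]
    (nabla : CovariantDerivative 𝓘(ℝ, E) E (TangentSpace 𝓘(ℝ, E) : M → Type _))
    (J : Π x : M, TangentSpace 𝓘(ℝ, E) x →L[ℝ] TangentSpace 𝓘(ℝ, E) x)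
    (u : TangentBundle 𝓘(ℝ, E) M) :
    TangentSpace 𝓘(ℝ, E).tangent u →L[ℝ] TangentSpace 𝓘(ℝ, E).tangent u :=
  (vLift u).comp ((J u.1).comp (vPart nabla u))
    - (hLift nabla u).comp ((J u.1).comp (hPart nabla u))

/-- `J₂ : x^H ↦ x^V, x^V ↦ -x^H`. -/
def J2 [FiniteDimensional ℝ E]
    (nabla : CovariantDerivative 𝓘(ℝ, E) E (TangentSpace 𝓘(ℝ, E) : M → Type _))
    (u : TangentBundle 𝓘(ℝ, E) M) :
    TangentSpace 𝓘(ℝ, E).tangent u →L[ℝ] TangentSpace 𝓘(ℝ, E).tangent u :=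
  (vLift u).comp (hPart nabla u) - (hLift nabla u).comp (vPart nabla u)

/-- `J₃ : x^H ↦ (Jx)^V, x^V ↦ (Jx)^H`. -/
def J3 [FiniteDimensional ℝ E]
    (nabla : CovariantDerivative 𝓘(ℝ, E) E (TangentSpace 𝓘(ℝ, E) : M → Type _))
    (J : Π x : M, TangentSpace 𝓘(ℝ, E) x →L[ℝ] TangentSpace 𝓘(ℝ, E) x)
    (u : TangentBundle 𝓘(ℝ, E) M) :
    TangentSpace 𝓘(ℝ, E).tangent u →L[ℝ] TangentSpace 𝓘(ℝ, E).tangent u :=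
  (vLift u).comp ((J u.1).comp (hPart nabla u))
    + (hLift nabla u).comp ((J u.1).comp (vPart nabla u))

/-- The horizontal lift `X^H` of a vector field `X` on `M`, a vector field on `TM`. -/
def hField (nabla : CovariantDerivative 𝓘(ℝ, E) E (TangentSpace 𝓘(ℝ, E) : M → Type _))
    (X : Π x : M, TangentSpace 𝓘(ℝ, E) x) (u : TangentBundle 𝓘(ℝ, E) M) :
    TangentSpace 𝓘(ℝ, E).tangent u :=
  hLift nabla u (X u.1)

/-- The vertical lift `X^V` of a vector field `X` on `M`, a vector field on `TM`. -/
def vField (X : Π x : M, TangentSpace 𝓘(ℝ, E) x) (u : TangentBundle 𝓘(ℝ, E) M) :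
    TangentSpace 𝓘(ℝ, E).tangent u :=
  vLift u (X u.1)

end TangentBundleLifts

end

/-!
A tangent vector of `TM` is determined by its projection to `M` and by the derivatives along it of
the functions `v ↦ g(v, Z)`. Testing brackets of lifts against these functions gives
`[X^H, Y^H] = [X, Y]^H - (R(X, Y)u)^V`, `[X^H, Y^V] = (∇_X Y)^V` and `[X^V, Y^V] = 0`. The Koszul
formula for `ĝ` then yields `∇̂_{X^H} Y^H = (∇_X Y)^H + (R(u, X)Y)^V`,
`∇̂_{X^H} Y^V = (∇_X Y)^V` and `∇̂_{X^V} Y^H = ∇̂_{X^V} Y^V = 0`, the curvature term by the pair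
symmetry of `R`. Since each `J_α` maps lifts to lifts, `(∇̂_{X^H} J_α)Y^H` and `(∇̂_{X^H} J_α)Y^V`
are now explicit, and pairing them with lifts of `Z`, with `J` moved across `g` by
`g(JX, Y) = g(X, JY)`, gives the components of `F_α`.
-/

open Filter Topology VectorField

theorem mvfderiv_congr {𝕜 : Type*} [NontriviallyNormedField 𝕜]
    {E : Type*} [NormedAddCommGroup E] [NormedSpace 𝕜 E]
    {H : Type*} [TopologicalSpace H] {I : ModelWithCorners 𝕜 E H}
    {M : Type*} [TopologicalSpace M] [ChartedSpace H M]
    {F : Type*} [NormedAddCommGroup F] [NormedSpace 𝕜 F]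
    {f g : M → F} {x : M} (h : f =ᶠ[𝓝 x] g) : d% f x = d% g x := by
  ext v
  exact DFunLike.congr_fun h.mfderiv_eq v

section SmoothVectorFields

variable {E : Type*} [NormedAddCommGroup E] [NormedSpace ℝ E]
  {H : Type*} [TopologicalSpace H] {I : ModelWithCorners ℝ E H}
  {M : Type*} [TopologicalSpace M] [ChartedSpace H M] [IsManifold I ∞ M]

theorem eventually_mdifferentiableAt_of_contMDiffAt {E' : Type*} [NormedAddCommGroup E']
    [NormedSpace ℝ E'] {H' : Type*} [TopologicalSpace H'] {I' : ModelWithCorners ℝ E' H'}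
    {N : Type*} [TopologicalSpace N] [ChartedSpace H' N] [IsManifold I' ∞ N] {f : M → N} {x : M}
    (hf : CMDiffAt ∞ f x) : ∀ᶠ y in 𝓝 x, MDiffAt f y :=
  ((contMDiffAt_iff_contMDiffAt_nhds (n := 1) (by simp)).1 (hf.of_le ENat.LEInfty.out)).mono
    fun _ hy ↦ hy.mdifferentiableAt one_ne_zero

theorem trivializationAt_tangentSpace_apply_snd {x y : M} (hy : y ∈ (chartAt H x).source)
    (v : TangentSpace I y) :
    (trivializationAt E (TangentSpace I) x ⟨y, v⟩).2 = d% (extChartAt I x) y v := by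
  have h := DFunLike.congr_fun (TangentBundle.continuousLinearMapAt_trivializationAt (I := I) hy) v
  rwa [Trivialization.continuousLinearMapAt_apply,
    Trivialization.coe_linearMapAt_of_mem _
      (by rwa [TangentBundle.trivializationAt_baseSet])] at h

theorem contMDiffAt_vectorField_iff {X : Π x : M, TangentSpace I x} {x : M} :
    CMDiffAt ∞ (T% X) x ↔ CMDiffAt ∞ (fun y ↦ d% (extChartAt I x) y (X y)) x := by
  rw [contMDiffAt_section]
  refine Filter.EventuallyEq.contMDiffAt_iff ?_
  filter_upwards [chart_source_mem_nhds H x] with y hy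
    using trivializationAt_tangentSpace_apply_snd hy (X y)

theorem contMDiffAt_mvfderiv_vectorField {F : Type*} [NormedAddCommGroup F] [NormedSpace ℝ F]
    {f : M → F} {X : Π x : M, TangentSpace I x} {x : M}
    (hf : CMDiffAt ∞ f x) (hX : CMDiffAt ∞ (T% X) x) :
    CMDiffAt ∞ (fun y ↦ d% f y (X y)) x := by
  have h := ContMDiffAt.clm_apply_of_inCoordinates (F₁ := E) (F₂ := F)
    (E₁ := (TangentSpace I : M → Type _)) (E₂ := (TangentSpace 𝓘(ℝ, F) : F → Type _))
    (b₁ := id) (b₂ := f) (ϕ := mfderiv I 𝓘(ℝ, F) f) (hf.mfderiv_const (m := ∞) (by simp)) hX hf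
  exact (contMDiff_snd_tangentBundle_modelSpace F 𝓘(ℝ, F)).contMDiffAt.comp x h

theorem eq_of_forall_mvfderiv_eq {x : M} {v w : TangentSpace I x}
    (h : ∀ f : M → ℝ, CMDiffAt ∞ f x → d% f x v = d% f x w) : v = w := by
  have hφ : CMDiffAt ∞ (extChartAt I x) x := contMDiffAt_extChartAt
  apply (isInvertible_mfderiv_extChartAt (I := I) (mem_extChartAt_source x)).injective
  refine (SeparatingDual.eq_iff_forall_dual_eq (R := ℝ) (V := E)).2 fun ℓ ↦ ?_
  have hcomp (z : TangentSpace I x) :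
      d% (fun y ↦ ℓ (extChartAt I x y)) x z = ℓ (d% (extChartAt I x) x z) := by
    have := (ℓ.hasMFDerivAt (x := extChartAt I x x)).comp x
      (hφ.mdifferentiableAt (by simp)).hasMFDerivAt
    exact DFunLike.congr_fun this.mfderiv z
  have := h (fun y ↦ ℓ (extChartAt I x y)) (ℓ.contMDiff.contMDiffAt.comp x hφ)
  rwa [hcomp, hcomp] at this

section LieBracket

variable [CompleteSpace E] {X Y Z : Π x : M, TangentSpace I x} {x : M}

theorem contMDiffAt_mlieBracket (hX : CMDiffAt ∞ (T% X) x) (hY : CMDiffAt ∞ (T% Y) x) :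
    CMDiffAt ∞ (T% (mlieBracket I X Y)) x := by
  have : IsManifold I (minSmoothness ℝ 3) M := by
    rw [minSmoothness_of_isRCLikeNormedField]; infer_instance
  have : IsManifold I (((⊤ : ℕ∞) : ℕ∞ω) + 1) M := inferInstanceAs (IsManifold I ∞ M)
  refine ContMDiffAt.mlieBracket_vectorField (m := ⊤) (n := ⊤) hX hY ?_
  rw [minSmoothness_of_isRCLikeNormedField]
  exact le_rfl

theorem mlieBracket_mlieBracket (hX : CMDiffAt ∞ (T% X) x) (hY : CMDiffAt ∞ (T% Y) x)
    (hZ : CMDiffAt ∞ (T% Z) x) :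
    mlieBracket I X (mlieBracket I Y Z) x
      = mlieBracket I (mlieBracket I X Y) Z x + mlieBracket I Y (mlieBracket I X Z) x := by
  have : IsManifold I (minSmoothness ℝ 3) M := by
    rw [minSmoothness_of_isRCLikeNormedField]; infer_instance
  have hmin : minSmoothness ℝ 2 ≤ ∞ := by
    rw [minSmoothness_of_isRCLikeNormedField]; exact ENat.LEInfty.out
  exact leibniz_identity_mlieBracket_apply (hX.of_le hmin) (hY.of_le hmin) (hZ.of_le hmin)

theorem mlieBracket_mlieBracket_cyclic (hX : CMDiffAt ∞ (T% X) x) (hY : CMDiffAt ∞ (T% Y) x)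
    (hZ : CMDiffAt ∞ (T% Z) x) :
    mlieBracket I X (mlieBracket I Y Z) x + mlieBracket I Y (mlieBracket I Z X) x
      + mlieBracket I Z (mlieBracket I X Y) x = 0 := by
  rw [mlieBracket_mlieBracket hX hY hZ, mlieBracket_swap_apply (V := Z),
    mlieBracket_swap (V := Z) (W := X)]
  have : mlieBracket I Y (-mlieBracket I X Z) x = -mlieBracket I Y (mlieBracket I X Z) x := by
    simpa using mlieBracket_const_smul_right (I := I) (V := Y) (c := (-1 : ℝ))
      ((contMDiffAt_mlieBracket hX hZ).mdifferentiableAt (by simp))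
  rw [this]
  abel

theorem mlieBracket_mlieBracket_smul {f : M → ℝ} (hf : CMDiffAt ∞ f x) (hY : CMDiffAt ∞ (T% Y) x)
    (hZ : CMDiffAt ∞ (T% Z) x) :
    mlieBracket I X (mlieBracket I Y (f • Z)) x
      = d% (fun y ↦ d% f y (Y y)) x (X x) • Z x + d% f x (Y x) • mlieBracket I X Z x
        + (d% f x (X x) • mlieBracket I Y Z x + f x • mlieBracket I X (mlieBracket I Y Z) x) := by
  have hf' := eventually_mdifferentiableAt_of_contMDiffAt hf
  have hZ' := eventually_mdifferentiableAt_of_contMDiffAt hZ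
  have hYf : MDiffAt (fun y ↦ d% f y (Y y)) x :=
    (contMDiffAt_mvfderiv_vectorField hf hY).mdifferentiableAt (by simp)
  have hYZ : MDiffAt (T% (mlieBracket I Y Z)) x :=
    (contMDiffAt_mlieBracket hY hZ).mdifferentiableAt (by simp)
  have hbracket : mlieBracket I Y (f • Z)
      =ᶠ[𝓝 x] (fun y ↦ d% f y (Y y)) • Z + f • mlieBracket I Y Z := by
    filter_upwards [hf', hZ'] with y hfy hZy
    exact mlieBracket_smul_right hfy hZy
  rw [EventuallyEq.rfl.mlieBracket_vectorField_eq hbracket,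
    mlieBracket_add_right (hYf.smul_section hZ'.self_of_nhds) (hf'.self_of_nhds.smul_section hYZ),
    mlieBracket_smul_right hYf hZ'.self_of_nhds, mlieBracket_smul_right hf'.self_of_nhds hYZ]

/- Both sides are read off from the Jacobi identity for `X`, `Y` and `f • Z`: the coefficients of
`Z x` on its two sides are the two sides of the claim. -/
theorem mvfderiv_mlieBracket {f : M → ℝ} (hf : CMDiffAt ∞ f x) (hX : CMDiffAt ∞ (T% X) x)
    (hY : CMDiffAt ∞ (T% Y) x) :
    d% f x (mlieBracket I X Y x)
      = d% (fun y ↦ d% f y (Y y)) x (X x) - d% (fun y ↦ d% f y (X y)) x (Y x) := by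
  rcases subsingleton_or_nontrivial (TangentSpace I x) with _ | _
  · simp [Subsingleton.elim (mlieBracket I X Y x) 0, Subsingleton.elim (X x) 0,
      Subsingleton.elim (Y x) 0]
  obtain ⟨z, hz⟩ := exists_ne (0 : TangentSpace I x)
  let Z : Π x : M, TangentSpace I x := FiberBundle.extend E z
  have hZ : CMDiffAt ∞ (T% Z) x := FiberBundle.contMDiffAt_extend I E z
  have hZx : Z x = z := FiberBundle.extend_apply_self E z
  have jacobi := mlieBracket_mlieBracket hX hY (hf.smul_section hZ)
  change mlieBracket I X (mlieBracket I Y (f • Z)) x = mlieBracket I (mlieBracket I X Y) (f • Z) x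
    + mlieBracket I Y (mlieBracket I X (f • Z)) x at jacobi
  rw [mlieBracket_mlieBracket_smul hf hY hZ, mlieBracket_mlieBracket_smul hf hX hZ,
    mlieBracket_smul_right (hf.mdifferentiableAt (by simp)) (hZ.mdifferentiableAt (by simp)),
    mlieBracket_mlieBracket hX hY hZ, hZx] at jacobi
  have hsmul : (d% f x (mlieBracket I X Y x) - (d% (fun y ↦ d% f y (Y y)) x (X x)
      - d% (fun y ↦ d% f y (X y)) x (Y x))) • z = 0 := by
    rw [← sub_eq_zero.2 jacobi.symm]
    module
  exact sub_eq_zero.1 ((smul_eq_zero.1 hsmul).resolve_right hz)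

end LieBracket

end SmoothVectorFields

section CovariantDerivative

variable {𝕜 : Type*} [NontriviallyNormedField 𝕜]
  {E : Type*} [NormedAddCommGroup E] [NormedSpace 𝕜 E]
  {H : Type*} [TopologicalSpace H] {I : ModelWithCorners 𝕜 E H}
  {M : Type*} [TopologicalSpace M] [ChartedSpace H M]
  {F : Type*} [NormedAddCommGroup F] [NormedSpace 𝕜 F]
  {V : M → Type*} [TopologicalSpace (TotalSpace F V)]
  [∀ x, AddCommGroup (V x)] [∀ x, Module 𝕜 (V x)] [∀ x, TopologicalSpace (V x)]
  [∀ x, IsTopologicalAddGroup (V x)] [∀ x, ContinuousSMul 𝕜 (V x)]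
  [FiberBundle F V] {s t : Π x : M, V x} {x : M}

theorem covariantDerivative_neg (cov : CovariantDerivative I F V) (hs : MDiffAt (T% s) x)
    (v : TangentSpace I x) : cov (fun y ↦ -s y) x v = -cov s x v := by
  have hneg : (fun y ↦ -s y) = (-1 : 𝕜) • s := by
    funext y
    simp
  rw [hneg, cov.isCovariantDerivativeOnUniv.smul_const (-1 : 𝕜) hs]
  simp

theorem covariantDerivative_sub [VectorBundle 𝕜 F V] (cov : CovariantDerivative I F V)
    (hs : MDiffAt (T% s) x) (ht : MDiffAt (T% t) x) (v : TangentSpace I x) :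
    cov (fun y ↦ s y - t y) x v = cov s x v - cov t x v := by
  have hsub : (fun y ↦ s y - t y) = s + fun y ↦ -t y := funext fun y ↦ sub_eq_add_neg _ _
  have ht' : MDiffAt (T% (fun y ↦ -t y)) x := mdifferentiableAt_neg_section ht
  rw [hsub, cov.isCovariantDerivativeOnUniv.add hs ht', add_apply, covariantDerivative_neg cov ht,
    sub_eq_add_neg]

end CovariantDerivative

section LocalFrames

variable {𝕜 : Type*} [NontriviallyNormedField 𝕜]
  {E : Type*} [NormedAddCommGroup E] [NormedSpace 𝕜 E]
  {H : Type*} [TopologicalSpace H] {I : ModelWithCorners 𝕜 E H}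
  {M : Type*} [TopologicalSpace M] [ChartedSpace H M]
  {F : Type*} [NormedAddCommGroup F] [NormedSpace 𝕜 F]
  {V : M → Type*} [TopologicalSpace (TotalSpace F V)]
  [∀ x, AddCommGroup (V x)] [∀ x, Module 𝕜 (V x)] [∀ x, TopologicalSpace (V x)]
  [FiberBundle F V] [VectorBundle 𝕜 F V]
  (e : Trivialization F (TotalSpace.proj : TotalSpace F V → M)) [MemTrivializationAtlas e]
  {ι : Type*} (b : Module.Basis ι 𝕜 F) {s : Π x : M, V x} {x : M}

theorem mvfderiv_localFrameCoeff [Finite ι] [ContMDiffVectorBundle 1 F V I] [CompleteSpace 𝕜]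
    (hx : x ∈ e.baseSet) (hs : MDiffAt (T% s) x) (i : ι)
    (v : TangentSpace I x) :
    d% (fun y ↦ e.localFrameCoeff I b i y (s y)) x v
      = b.repr (d% (fun y ↦ (e ⟨y, s y⟩).2) x v) i := by
  have := b.finiteDimensional_of_finite
  have hread : MDiffAt (fun y ↦ (e ⟨y, s y⟩).2) x := (e.mdifferentiableAt_section_iff I s hx).1 hs
  have hcoeff : (fun y ↦ e.localFrameCoeff I b i y (s y))
      =ᶠ[𝓝 x] fun y ↦ (b.coord i).toContinuousLinearMap (e ⟨y, s y⟩).2 := by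
    filter_upwards [e.open_baseSet.mem_nhds hx] with y hy
    exact e.localFrameCoeff_eq_coeff hy
  rw [mvfderiv_congr hcoeff]
  exact DFunLike.congr_fun ((b.coord i).toContinuousLinearMap.hasMFDerivAt.comp x
    hread.hasMFDerivAt).mfderiv v

variable [∀ x, IsTopologicalAddGroup (V x)] [∀ x, ContinuousSMul 𝕜 (V x)]

theorem covariantDerivative_sum_smul {ι : Type*} (cov : CovariantDerivative I F V) (t : Finset ι)
    {c : ι → M → 𝕜} {s : ι → Π x : M, V x} {x : M}
    (hc : ∀ i ∈ t, MDiffAt (c i) x) (hs : ∀ i ∈ t, MDiffAt (T% (s i)) x)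
    (v : TangentSpace I x) :
    cov (fun y ↦ ∑ i ∈ t, c i y • s i y) x v
      = ∑ i ∈ t, (c i x • cov (s i) x v + d% (c i) x v • s i x) := by
  classical
  induction t using Finset.induction_on with
  | empty =>
    have hzero : (fun y ↦ ∑ i ∈ (∅ : Finset ι), c i y • s i y) = (0 : Π x : M, V x) := rfl
    rw [hzero, cov.zero]
    rfl
  | insert a t ha ih =>
    obtain ⟨hca, hc⟩ := Finset.forall_mem_insert .. |>.1 hc
    obtain ⟨hsa, hs⟩ := Finset.forall_mem_insert .. |>.1 hs
    have hinsert : (fun y ↦ ∑ i ∈ insert a t, c i y • s i y)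
        = c a • s a + fun y ↦ ∑ i ∈ t, c i y • s i y := by
      funext y
      exact Finset.sum_insert ha
    have hsum : MDiffAt (T% (fun y ↦ ∑ i ∈ t, c i y • s i y)) x :=
      MDifferentiableAt.sum_section fun i hi ↦ (hc i hi).smul_section (hs i hi)
    rw [hinsert, cov.isCovariantDerivativeOnUniv.add (hca.smul_section hsa) hsum,
      cov.isCovariantDerivativeOnUniv.leibniz hsa hca, Finset.sum_insert ha, ← ih hc hs]
    rfl

variable [Fintype ι] [ContMDiffVectorBundle 1 F V I] [CompleteSpace 𝕜]

theorem covariantDerivative_eq_sum_localFrame (cov : CovariantDerivative I F V)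
    (hx : x ∈ e.baseSet) (hs : MDiffAt (T% s) x) (v : TangentSpace I x) :
    cov s x v = ∑ i, (e.localFrameCoeff I b i x (s x) • cov (e.localFrame b i) x v
      + d% (fun y ↦ e.localFrameCoeff I b i y (s y)) x v • e.localFrame b i x) := by
  have := b.finiteDimensional_of_finite
  have hcoeff (i : ι) : MDiffAt (fun y ↦ e.localFrameCoeff I b i y (s y)) x :=
    mdifferentiableAt_localFrameCoeff b hx hs i
  have hframe (i : ι) : MDiffAt (T% (e.localFrame b i)) x :=
    (contMDiffAt_localFrame_of_mem (n := 1) e b i hx).mdifferentiableAt one_ne_zero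
  rw [← covariantDerivative_sum_smul cov Finset.univ (fun i _ ↦ hcoeff i) (fun i _ ↦ hframe i)]
  congr 1
  exact cov.isCovariantDerivativeOnUniv.congr_of_eventuallyEq hs
    (MDifferentiableAt.sum_section fun i _ ↦ (hcoeff i).smul_section (hframe i)) univ_mem
    (e.eventually_eq_localFrame_sum_coeff_smul b hx)

theorem trivialization_covariantDerivative (cov : CovariantDerivative I F V)
    (hx : x ∈ e.baseSet) (hs : MDiffAt (T% s) x) (v : TangentSpace I x) :
    e.continuousLinearMapAt 𝕜 x (cov s x v) = d% (fun y ↦ (e ⟨y, s y⟩).2) x v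
      + ∑ i, b.repr (e ⟨x, s x⟩).2 i •
        e.continuousLinearMapAt 𝕜 x (cov (e.localFrame b i) x v) := by
  have hframe (i : ι) : e.continuousLinearMapAt 𝕜 x (e.localFrame b i x) = b i := by
    rw [e.localFrame_apply_of_mem_baseSet b hx, Trivialization.basisAt, Module.Basis.map_apply]
    rw [Trivialization.continuousLinearMapAt_apply, e.linearMapAt_def_of_mem hx]
    exact (e.linearEquivAt 𝕜 x hx).apply_symm_apply (b i)
  rw [covariantDerivative_eq_sum_localFrame e b cov hx hs]
  simp only [map_sum, map_add, map_smul, hframe, mvfderiv_localFrameCoeff e b hx hs,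
    Finset.sum_add_distrib, e.localFrameCoeff_eq_coeff (I := I) hx]
  rw [add_comm, b.sum_repr]

end LocalFrames

noncomputable section TangentBundleVectorFields

variable {E : Type*} [NormedAddCommGroup E] [NormedSpace ℝ E]
  {M : Type*} [TopologicalSpace M] [ChartedSpace E M] [IsManifold 𝓘(ℝ, E) ∞ M]
  {nabla : CovariantDerivative 𝓘(ℝ, E) E (TangentSpace 𝓘(ℝ, E) : M → Type _)}
  {X : Π x : M, TangentSpace 𝓘(ℝ, E) x} {u : TangentBundle 𝓘(ℝ, E) M} {p : M}

section DerivativesAlongLifts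

variable {F : Type*} [NormedAddCommGroup F] [NormedSpace ℝ F]
  {f : TangentBundle 𝓘(ℝ, E) M → F}

theorem mvfderiv_vLift (hf : MDiffAt f u) (w : TangentSpace 𝓘(ℝ, E) u.1) :
    d% f u (vLift u w) = fderiv ℝ (fun v : E ↦ f ⟨u.1, v⟩) u.2 w := by
  obtain ⟨p, (v : E)⟩ := u
  rw [← mfderiv_eq_fderiv]
  exact (mfderiv_comp_apply v hf (mdifferentiableAt_fiber p v) w).symm

theorem mvfderiv_extendDeriv (hf : MDiffAt f u) (v : TangentSpace 𝓘(ℝ, E) u.1) :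
    d% f u (extendDeriv u v) = d% (fun q ↦ f ⟨q, FiberBundle.extend E u.2 q⟩) u.1 v := by
  have hu : (⟨u.1, FiberBundle.extend E u.2 u.1⟩ : TangentBundle 𝓘(ℝ, E) M) = u := by
    rw [FiberBundle.extend_apply_self]
  exact (mfderiv_comp_apply_of_eq u.1 hf
    (FiberBundle.mdifferentiableAt_extend 𝓘(ℝ, E) E u.2) hu v).symm

theorem mvfderiv_hLift (hf : MDiffAt f u) (v : TangentSpace 𝓘(ℝ, E) u.1) :
    d% f u (hLift nabla u v) = d% (fun q ↦ f ⟨q, FiberBundle.extend E u.2 q⟩) u.1 v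
      - d% f u (vLift u (nabla (FiberBundle.extend E u.2) u.1 v)) := by
  rw [← mvfderiv_extendDeriv hf, ← map_sub]
  rfl

theorem mvfderiv_comp_proj {f : M → F} (hf : MDiffAt f u.1) (ξ : TangentSpace 𝓘(ℝ, E).tangent u) :
    d% (fun w : TangentBundle 𝓘(ℝ, E) M ↦ f w.1) u ξ = d% f u.1 (dProj u ξ) :=
  mfderiv_comp_apply u hf (mdifferentiableAt_proj (TangentSpace 𝓘(ℝ, E))) ξ

end DerivativesAlongLifts

/-- The second component of the trivialization of `TM` at `p`, i.e. the fibre part of the chart of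
`TM` at any point over `p`. -/
def fiberCoord (p : M) (u : TangentBundle 𝓘(ℝ, E) M) : E :=
  (trivializationAt E (TangentSpace 𝓘(ℝ, E)) p u).2

theorem contMDiffAt_fiberCoord (u : TangentBundle 𝓘(ℝ, E) M) :
    CMDiffAt ∞ (fiberCoord (E := E) u.1) u :=
  (contMDiffAt_totalSpace.1 (contMDiffAt_id (x := u) (I := 𝓘(ℝ, E).tangent) (n := ∞))).2

theorem contMDiffAt_proj_tangentBundle (u : TangentBundle 𝓘(ℝ, E) M) :
    CMDiffAt ∞ (fun w : TangentBundle 𝓘(ℝ, E) M ↦ w.1) u :=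
  contMDiffAt_proj (TangentSpace 𝓘(ℝ, E))

theorem extChartAt_tangentBundle (u : TangentBundle 𝓘(ℝ, E) M) :
    (extChartAt 𝓘(ℝ, E).tangent u : TangentBundle 𝓘(ℝ, E) M → E × E)
      = fun w ↦ (extChartAt 𝓘(ℝ, E) u.1 w.1, fiberCoord u.1 w) := by
  have h : extChartAt 𝓘(ℝ, E).tangent u = _ :=
    FiberBundle.extChartAt (IB := 𝓘(ℝ, E)) (F := E) (E := (TangentSpace 𝓘(ℝ, E) : M → Type _)) u
  funext w
  rw [h]
  rfl

theorem mvfderiv_extChartAt_tangentBundle {w : TangentBundle 𝓘(ℝ, E) M}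
    (hbase : MDiffAt (extChartAt 𝓘(ℝ, E) u.1) w.1) (hfiber : MDiffAt (fiberCoord (E := E) u.1) w)
    (ξ : TangentSpace 𝓘(ℝ, E).tangent w) :
    mfderiv 𝓘(ℝ, E).tangent 𝓘(ℝ, E × E) (extChartAt 𝓘(ℝ, E).tangent u) w ξ
      = (d% (extChartAt 𝓘(ℝ, E) u.1) w.1 (dProj w ξ), d% (fiberCoord (E := E) u.1) w ξ) := by
  have hproj := hbase.hasMFDerivAt.comp w
    (mdifferentiableAt_proj (TangentSpace 𝓘(ℝ, E))).hasMFDerivAt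
  have hchart := (hproj.mdifferentiableAt.prodMk_space hfiber).hasMFDerivAt
  have hfst := hasMFDerivAt_unique
    ((ContinuousLinearMap.fst ℝ E E).hasMFDerivAt.comp w hchart) hproj
  have hsnd := hasMFDerivAt_unique
    ((ContinuousLinearMap.snd ℝ E E).hasMFDerivAt.comp w hchart) hfiber.hasMFDerivAt
  rw [extChartAt_tangentBundle]
  exact Prod.ext (DFunLike.congr_fun hfst ξ) (DFunLike.congr_fun hsnd ξ)

theorem contMDiffAt_vectorField_tangentBundle
    {A : Π u : TangentBundle 𝓘(ℝ, E) M, TangentSpace 𝓘(ℝ, E).tangent u}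
    (hbase : CMDiffAt ∞ (fun w ↦ d% (extChartAt 𝓘(ℝ, E) u.1) w.1 (dProj w (A w))) u)
    (hfiber : CMDiffAt ∞ (fun w ↦ d% (fiberCoord (E := E) u.1) w (A w)) u) :
    CMDiffAt ∞ (T% A) u := by
  rw [contMDiffAt_vectorField_iff]
  have hφ : CMDiffAt ∞ (extChartAt 𝓘(ℝ, E) u.1) u.1 := contMDiffAt_extChartAt
  refine (hbase.prodMk_space hfiber).congr_of_eventuallyEq ?_
  filter_upwards [eventually_mdifferentiableAt_of_contMDiffAt (contMDiffAt_fiberCoord u),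
    (contMDiffAt_proj_tangentBundle u).continuousAt.eventually
      (eventually_mdifferentiableAt_of_contMDiffAt hφ)]
    with w hw hw' using mvfderiv_extChartAt_tangentBundle hw' hw (A w)

theorem eventually_mem_baseSet_trivializationAt (u : TangentBundle 𝓘(ℝ, E) M) :
    ∀ᶠ w : TangentBundle 𝓘(ℝ, E) M in 𝓝 u,
      w.1 ∈ (trivializationAt E (TangentSpace 𝓘(ℝ, E)) u.1).baseSet :=
  (contMDiffAt_proj_tangentBundle u).continuousAt.eventually
    ((trivializationAt E (TangentSpace 𝓘(ℝ, E)) u.1).open_baseSet.mem_nhds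
      (FiberBundle.mem_baseSet_trivializationAt' u.1))

theorem continuousLinearMapAt_trivializationAt_apply
    (hp : u.1 ∈ (trivializationAt E (TangentSpace 𝓘(ℝ, E)) p).baseSet)
    (v : TangentSpace 𝓘(ℝ, E) u.1) :
    (trivializationAt E (TangentSpace 𝓘(ℝ, E)) p).continuousLinearMapAt ℝ u.1 v
      = fiberCoord p ⟨u.1, v⟩ := by
  rw [Trivialization.continuousLinearMapAt_apply, Trivialization.coe_linearMapAt_of_mem _ hp]
  rfl

theorem mvfderiv_fiberCoord_vLift
    (hp : u.1 ∈ (trivializationAt E (TangentSpace 𝓘(ℝ, E)) p).baseSet)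
    (hd : MDiffAt (fiberCoord (E := E) p) u) (w : TangentSpace 𝓘(ℝ, E) u.1) :
    d% (fiberCoord (E := E) p) u (vLift u w) = fiberCoord p ⟨u.1, w⟩ := by
  let L : E →L[ℝ] E :=
    (trivializationAt E (TangentSpace 𝓘(ℝ, E)) p).continuousLinearMapAt ℝ u.1
  have hL : (fun v : E ↦ fiberCoord p (⟨u.1, v⟩ : TangentBundle 𝓘(ℝ, E) M)) = L :=
    funext fun v ↦ (continuousLinearMapAt_trivializationAt_apply hp v).symm
  rw [mvfderiv_vLift hd, hL]
  exact (DFunLike.congr_fun (L.fderiv (x := u.2)) w).trans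
    (continuousLinearMapAt_trivializationAt_apply hp w)

/- The derivative of the local section cancels: only the Christoffel symbols of `nabla` in the
coordinate frame survive. -/
theorem mvfderiv_fiberCoord_hLift {ι : Type*} [Fintype ι] (b : Module.Basis ι ℝ E)
    (hp : u.1 ∈ (trivializationAt E (TangentSpace 𝓘(ℝ, E)) p).baseSet)
    (hd : MDiffAt (fiberCoord (E := E) p) u) (v : TangentSpace 𝓘(ℝ, E) u.1) :
    d% (fiberCoord (E := E) p) u (hLift nabla u v)
      = -∑ i, b.repr (fiberCoord p u) i • fiberCoord p ⟨u.1, nabla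
          ((trivializationAt E (TangentSpace 𝓘(ℝ, E)) p).localFrame b i) u.1 v⟩ := by
  have htriv := trivialization_covariantDerivative (trivializationAt E (TangentSpace 𝓘(ℝ, E)) p) b
    nabla hp (FiberBundle.mdifferentiableAt_extend 𝓘(ℝ, E) E u.2) v
  simp only [continuousLinearMapAt_trivializationAt_apply hp, FiberBundle.extend_apply_self]
    at htriv
  rw [mvfderiv_hLift hd, mvfderiv_fiberCoord_vLift hp hd, htriv]
  exact sub_add_cancel_left _ _

theorem contMDiffAt_vField (hX : CMDiffAt ∞ (T% X) u.1) : CMDiffAt ∞ (T% (vField X)) u := by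
  refine contMDiffAt_vectorField_tangentBundle ?_ ?_
  · simp only [vField, dProj_vLift, map_zero]
    exact contMDiffAt_const
  · refine (((contMDiffAt_section u.1).1 hX).comp u
      (contMDiffAt_proj_tangentBundle u)).congr_of_eventuallyEq ?_
    filter_upwards [eventually_mdifferentiableAt_of_contMDiffAt (contMDiffAt_fiberCoord u),
      eventually_mem_baseSet_trivializationAt u] with w hw hw'
    exact mvfderiv_fiberCoord_vLift hw' hw _

theorem mdifferentiableAt_vField (hX : CMDiffAt ∞ (T% X) u.1) : MDiffAt (T% (vField X)) u :=
  (contMDiffAt_vField hX).mdifferentiableAt (by simp)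

theorem contMDiffAt_hField [FiniteDimensional ℝ E]
    (hnabla : ∀ (X Y : Π x : M, TangentSpace 𝓘(ℝ, E) x) (x : M),
      CMDiffAt ∞ (T% X) x → CMDiffAt ∞ (T% Y) x → CMDiffAt ∞ (T% (fun y ↦ nabla Y y (X y))) x)
    (hX : CMDiffAt ∞ (T% X) u.1) : CMDiffAt ∞ (T% (hField nabla X)) u := by
  have hπ := contMDiffAt_proj_tangentBundle u
  refine contMDiffAt_vectorField_tangentBundle ?_ ?_
  · simp only [hField, dProj_hLift]
    exact (contMDiffAt_vectorField_iff.1 hX).comp u hπ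
  let b := Module.finBasis ℝ E
  let e := trivializationAt E (TangentSpace 𝓘(ℝ, E)) u.1
  have hcoord i : CMDiffAt ∞ (fun w ↦ b.repr (fiberCoord u.1 w) i) u :=
    ((b.coord i).toContinuousLinearMap.contMDiff.contMDiffAt).comp u (contMDiffAt_fiberCoord u)
  have hchristoffel i : CMDiffAt ∞ (fun w : TangentBundle 𝓘(ℝ, E) M ↦
      fiberCoord u.1 ⟨w.1, nabla (e.localFrame b i) w.1 (X w.1)⟩) u :=
    ((contMDiffAt_section u.1).1 (hnabla X (e.localFrame b i) u.1 hX
      (contMDiffAt_localFrame_of_mem (n := ∞) e b i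
        (FiberBundle.mem_baseSet_trivializationAt' u.1)))).comp u hπ
  refine (contMDiffAt_finsetSum (t := Finset.univ)
    fun i _ ↦ (hcoord i).smul (hchristoffel i)).neg.congr_of_eventuallyEq ?_
  filter_upwards [eventually_mdifferentiableAt_of_contMDiffAt (contMDiffAt_fiberCoord u),
    eventually_mem_baseSet_trivializationAt u] with w hw hw'
  exact mvfderiv_fiberCoord_hLift b hw' hw _

end TangentBundleVectorFields

section PseudoRiemannianGeometry

variable {E : Type*} [NormedAddCommGroup E] [NormedSpace ℝ E]
  {H : Type*} [TopologicalSpace H] {I : ModelWithCorners ℝ E H}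
  {M : Type*} [TopologicalSpace M] [ChartedSpace H M] [IsManifold I ∞ M]
  {g : Π x : M, TangentSpace I x →L[ℝ] TangentSpace I x →L[ℝ] ℝ}
  {cov : CovariantDerivative I E (TangentSpace I : M → Type _)}
  {X Y Z W : Π x : M, TangentSpace I x} {x : M}

/-- The field `g` of bilinear forms is a pseudo-Riemannian metric of class `C^∞`, of arbitrary
signature. -/
structure IsPseudoRiemannianMetric
    (g : Π x : M, TangentSpace I x →L[ℝ] TangentSpace I x →L[ℝ] ℝ) : Prop where
  symm : ∀ (x : M) (v w : TangentSpace I x), g x v w = g x w v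
  nondegenerate : ∀ (x : M) (v : TangentSpace I x), (∀ w, g x v w = 0) → v = 0
  contMDiff : ContMDiff I (I.prod 𝓘(ℝ, E →L[ℝ] E →L[ℝ] ℝ)) ∞
    (fun x : M ↦ TotalSpace.mk' (E →L[ℝ] E →L[ℝ] ℝ)
      (E := fun x : M ↦ TangentSpace I x →L[ℝ] TangentSpace I x →L[ℝ] ℝ) x (g x))

theorem IsPseudoRiemannianMetric.contMDiffAt_apply (hg : IsPseudoRiemannianMetric g)
    (hX : CMDiffAt ∞ (T% X) x) (hY : CMDiffAt ∞ (T% Y) x) :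
    CMDiffAt ∞ (fun y ↦ g y (X y) (Y y)) x :=
  (contMDiffAt_totalSpace.1 (ContMDiffAt.clm_bundle_apply₂ (F₁ := E) (F₂ := E) (F₃ := ℝ)
    (E₃ := Bundle.Trivial M ℝ) (hg.contMDiff x) hX hY)).2

theorem IsPseudoRiemannianMetric.eq_of_forall_apply_eq (hg : IsPseudoRiemannianMetric g)
    {v w : TangentSpace I x} (h : ∀ z, g x v z = g x w z) : v = w :=
  sub_eq_zero.1 (hg.nondegenerate x _ fun z ↦ by simp [h])

theorem curvatureOp_swap (X Y Z : Π x : M, TangentSpace I x) (x : M) :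
    curvatureOp cov X Y Z x = -curvatureOp cov Y X Z x := by
  simp only [curvatureOp, mlieBracket_swap_apply (V := X), map_neg]
  abel

theorem curvatureForm_swap_left (X Y Z W : Π x : M, TangentSpace I x) (x : M) :
    curvatureForm g cov X Y Z W x = -curvatureForm g cov Y X Z W x := by
  rw [curvatureForm, curvatureOp_swap, map_neg]
  rfl

namespace IsLeviCivita

theorem koszul (hcov : IsLeviCivita g cov) (hg : ∀ x v w, g x v w = g x w v)
    (hX : MDiffAt (T% X) x) (hY : MDiffAt (T% Y) x) (hZ : MDiffAt (T% Z) x) :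
    2 * g x (cov Y x (X x)) (Z x)
      = d% (fun y ↦ g y (Y y) (Z y)) x (X x) + d% (fun y ↦ g y (X y) (Z y)) x (Y x)
        - d% (fun y ↦ g y (X y) (Y y)) x (Z x) + g x (mlieBracket I X Y x) (Z x)
        - g x (mlieBracket I X Z x) (Y x) - g x (mlieBracket I Y Z x) (X x) := by
  rw [hcov.metric X Y Z x hY hZ, hcov.metric Y X Z x hX hZ, hcov.metric Z X Y x hX hY,
    ← hcov.torsion_free X Y x hX hY, ← hcov.torsion_free X Z x hX hZ,
    ← hcov.torsion_free Y Z x hY hZ]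
  simp only [map_sub, sub_apply]
  rw [hg x (Y x) (cov Z x (X x)), hg x (X x) (cov Z x (Y x)), hg x (X x) (cov Y x (Z x))]
  ring

theorem mvfderiv_mvfderiv_apply (hcov : IsLeviCivita g cov) (hg : IsPseudoRiemannianMetric g)
    (X : Π x : M, TangentSpace I x) (hY : CMDiffAt ∞ (T% Y) x) (hZ : CMDiffAt ∞ (T% Z) x)
    (hW : CMDiffAt ∞ (T% W) x) :
    d% (fun y ↦ d% (fun z ↦ g z (Z z) (W z)) y (Y y)) x (X x)
      = g x (cov (fun y ↦ cov Z y (Y y)) x (X x)) (W x)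
        + g x (cov Z x (Y x)) (cov W x (X x)) + (g x (cov Z x (X x)) (cov W x (Y x))
        + g x (Z x) (cov (fun y ↦ cov W y (Y y)) x (X x))) := by
  have hYZ := hcov.smooth Y Z x hY hZ
  have hYW := hcov.smooth Y W x hY hW
  have hmetric : (fun y ↦ d% (fun z ↦ g z (Z z) (W z)) y (Y y))
      =ᶠ[𝓝 x] fun y ↦ g y (cov Z y (Y y)) (W y) + g y (Z y) (cov W y (Y y)) := by
    filter_upwards [eventually_mdifferentiableAt_of_contMDiffAt hZ,
      eventually_mdifferentiableAt_of_contMDiffAt hW] with y hy hy'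
      using hcov.metric Y Z W y hy hy'
  rw [mvfderiv_congr hmetric,
    mvfderiv_fun_add ((hg.contMDiffAt_apply hYZ hW).mdifferentiableAt (by simp))
      ((hg.contMDiffAt_apply hZ hYW).mdifferentiableAt (by simp)),
    add_apply,
    hcov.metric X _ W x (hYZ.mdifferentiableAt (by simp)) (hW.mdifferentiableAt (by simp)),
    hcov.metric X Z _ x (hZ.mdifferentiableAt (by simp)) (hYW.mdifferentiableAt (by simp))]

section Curvature

variable [CompleteSpace E]

theorem mlieBracket_mlieBracket_eq (hcov : IsLeviCivita g cov) (hX : CMDiffAt ∞ (T% X) x)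
    (hY : CMDiffAt ∞ (T% Y) x) (hZ : CMDiffAt ∞ (T% Z) x) :
    mlieBracket I X (mlieBracket I Y Z) x
      = cov (fun y ↦ cov Z y (Y y)) x (X x) - cov (fun y ↦ cov Y y (Z y)) x (X x)
        - cov X x (mlieBracket I Y Z x) := by
  have hYZ : MDiffAt (T% (mlieBracket I Y Z)) x :=
    (contMDiffAt_mlieBracket hY hZ).mdifferentiableAt (by simp)
  have hcovYZ := (hcov.smooth Y Z x hY hZ).mdifferentiableAt (n := ∞) (by simp)
  have hcovZY := (hcov.smooth Z Y x hZ hY).mdifferentiableAt (n := ∞) (by simp)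
  have htorsion : cov (fun y ↦ cov Z y (Y y) - cov Y y (Z y)) x = cov (mlieBracket I Y Z) x := by
    refine cov.isCovariantDerivativeOnUniv.congr_of_eventuallyEq
      (mdifferentiableAt_sub_section hcovYZ hcovZY) hYZ univ_mem ?_
    filter_upwards [eventually_mdifferentiableAt_of_contMDiffAt hY,
      eventually_mdifferentiableAt_of_contMDiffAt hZ] with y hy hy'
      using hcov.torsion_free Y Z y hy hy'
  rw [← covariantDerivative_sub cov hcovYZ hcovZY, htorsion,
    hcov.torsion_free X _ x (hX.mdifferentiableAt (by simp)) hYZ]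

theorem curvatureOp_cyclic (hcov : IsLeviCivita g cov) (hX : CMDiffAt ∞ (T% X) x)
    (hY : CMDiffAt ∞ (T% Y) x) (hZ : CMDiffAt ∞ (T% Z) x) :
    curvatureOp cov X Y Z x + curvatureOp cov Y Z X x + curvatureOp cov Z X Y x = 0 := by
  rw [← mlieBracket_mlieBracket_cyclic hX hY hZ, hcov.mlieBracket_mlieBracket_eq hX hY hZ,
    hcov.mlieBracket_mlieBracket_eq hY hZ hX, hcov.mlieBracket_mlieBracket_eq hZ hX hY]
  simp only [curvatureOp]
  abel

theorem curvatureForm_cyclic (hcov : IsLeviCivita g cov) (W : Π x : M, TangentSpace I x)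
    (hX : CMDiffAt ∞ (T% X) x) (hY : CMDiffAt ∞ (T% Y) x) (hZ : CMDiffAt ∞ (T% Z) x) :
    curvatureForm g cov X Y Z W x + curvatureForm g cov Y Z X W x
      + curvatureForm g cov Z X Y W x = 0 := by
  simpa [curvatureForm] using congrArg (g x · (W x)) (hcov.curvatureOp_cyclic hX hY hZ)

/- Skewness expresses that `X (Y f) - Y (X f) - [X, Y] f` vanishes for `f = g(Z, W)`. -/
theorem curvatureForm_swap_right (hcov : IsLeviCivita g cov) (hg : IsPseudoRiemannianMetric g)
    (hX : CMDiffAt ∞ (T% X) x) (hY : CMDiffAt ∞ (T% Y) x)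
    (hZ : CMDiffAt ∞ (T% Z) x) (hW : CMDiffAt ∞ (T% W) x) :
    curvatureForm g cov X Y Z W x = -curvatureForm g cov X Y W Z x := by
  have hbracket := mvfderiv_mlieBracket (hg.contMDiffAt_apply hZ hW) hX hY
  rw [hcov.metric (mlieBracket I X Y) Z W x (hZ.mdifferentiableAt (by simp))
      (hW.mdifferentiableAt (by simp)),
    hcov.mvfderiv_mvfderiv_apply hg X hY hZ hW, hcov.mvfderiv_mvfderiv_apply hg Y hX hZ hW]
    at hbracket
  simp only [curvatureForm, curvatureOp, map_sub, sub_apply, hg.symm x _ (Z x)]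
  linarith

theorem curvatureForm_pair_symm (hcov : IsLeviCivita g cov) (hg : IsPseudoRiemannianMetric g)
    (hX : CMDiffAt ∞ (T% X) x) (hY : CMDiffAt ∞ (T% Y) x)
    (hZ : CMDiffAt ∞ (T% Z) x) (hW : CMDiffAt ∞ (T% W) x) :
    curvatureForm g cov X Y Z W x = curvatureForm g cov Z W X Y x := by
  linarith [hcov.curvatureForm_cyclic W hX hY hZ, hcov.curvatureForm_cyclic X hY hZ hW,
    hcov.curvatureForm_cyclic Y hZ hW hX, hcov.curvatureForm_cyclic Z hW hX hY,
    hcov.curvatureForm_swap_right hg hX hY hZ hW, hcov.curvatureForm_swap_right hg hY hZ hX hW,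
    hcov.curvatureForm_swap_right hg hZ hX hY hW, hcov.curvatureForm_swap_right hg hZ hW hY hX,
    hcov.curvatureForm_swap_right hg hW hY hZ hX, hcov.curvatureForm_swap_right hg hW hX hZ hY,
    curvatureForm_swap_left (g := g) (cov := cov) X Z Y W x,
    curvatureForm_swap_left (g := g) (cov := cov) X Z W Y x,
    curvatureForm_swap_left (g := g) (cov := cov) Y W X Z x,
    curvatureForm_swap_left (g := g) (cov := cov) Y W Z X x]

theorem two_mul_curvatureForm_eq (hcov : IsLeviCivita g cov) (hg : IsPseudoRiemannianMetric g)
    (hX : CMDiffAt ∞ (T% X) x) (hY : CMDiffAt ∞ (T% Y) x)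
    (hZ : CMDiffAt ∞ (T% Z) x) (hW : CMDiffAt ∞ (T% W) x) :
    2 * curvatureForm g cov X Y Z W x = curvatureForm g cov Y W X Z x
      + curvatureForm g cov Z W X Y x - curvatureForm g cov Y Z X W x := by
  linarith [hcov.curvatureForm_cyclic X hY hZ hW, hcov.curvatureForm_pair_symm hg hX hY hZ hW,
    hcov.curvatureForm_swap_right hg hZ hW hX hY, hcov.curvatureForm_swap_right hg hY hZ hX hW,
    hcov.curvatureForm_swap_right hg hY hW hX hZ,
    curvatureForm_swap_left (g := g) (cov := cov) Y W Z X x]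

end Curvature

end IsLeviCivita

end PseudoRiemannianGeometry

section HorizontalAndVerticalParts

variable {E : Type*} [NormedAddCommGroup E] [NormedSpace ℝ E] [FiniteDimensional ℝ E]
  {M : Type*} [TopologicalSpace M] [ChartedSpace E M] [IsManifold 𝓘(ℝ, E) ∞ M]
  (nabla : CovariantDerivative 𝓘(ℝ, E) E (TangentSpace 𝓘(ℝ, E) : M → Type _))
  {u : TangentBundle 𝓘(ℝ, E) M}

@[simp] theorem hPart_hLift (v : TangentSpace 𝓘(ℝ, E) u.1) : hPart nabla u (hLift nabla u v) = v :=
  congrArg Prod.fst (liftEquiv_symm_hLift nabla u v)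

@[simp] theorem vPart_hLift (v : TangentSpace 𝓘(ℝ, E) u.1) : vPart nabla u (hLift nabla u v) = 0 :=
  congrArg Prod.snd (liftEquiv_symm_hLift nabla u v)

@[simp] theorem hPart_vLift (v : TangentSpace 𝓘(ℝ, E) u.1) : hPart nabla u (vLift u v) = 0 :=
  congrArg Prod.fst (liftEquiv_symm_vLift nabla u v)

@[simp] theorem vPart_vLift (v : TangentSpace 𝓘(ℝ, E) u.1) : vPart nabla u (vLift u v) = v :=
  congrArg Prod.snd (liftEquiv_symm_vLift nabla u v)

theorem hLift_hPart_add_vLift_vPart (ξ : TangentSpace 𝓘(ℝ, E).tangent u) :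
    hLift nabla u (hPart nabla u ξ) + vLift u (vPart nabla u ξ) = ξ :=
  (liftEquiv nabla u).apply_symm_apply ξ

theorem hPart_eq_dProj (ξ : TangentSpace 𝓘(ℝ, E).tangent u) : hPart nabla u ξ = dProj u ξ := by
  conv_rhs => rw [← hLift_hPart_add_vLift_vPart nabla ξ]
  rw [map_add, dProj_hLift, dProj_vLift, add_zero]

end HorizontalAndVerticalParts

noncomputable section FiberwiseLinearFunctions

variable {E : Type*} [NormedAddCommGroup E] [NormedSpace ℝ E]
  {M : Type*} [TopologicalSpace M] [ChartedSpace E M] [IsManifold 𝓘(ℝ, E) ∞ M]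
  {g : Π x : M, TangentSpace 𝓘(ℝ, E) x →L[ℝ] TangentSpace 𝓘(ℝ, E) x →L[ℝ] ℝ}
  {nabla : CovariantDerivative 𝓘(ℝ, E) E (TangentSpace 𝓘(ℝ, E) : M → Type _)}
  {X Y Z U : Π x : M, TangentSpace 𝓘(ℝ, E) x} {u : TangentBundle 𝓘(ℝ, E) M}

/-- The fibrewise linear function `u ↦ g(Z, u)` on `TM` determined by a vector field `Z`. Together
with the functions pulled back from `M`, these detect tangent vectors of `TM`. -/
def flatFun (g : Π x : M, TangentSpace 𝓘(ℝ, E) x →L[ℝ] TangentSpace 𝓘(ℝ, E) x →L[ℝ] ℝ)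
    (Z : Π x : M, TangentSpace 𝓘(ℝ, E) x) (u : TangentBundle 𝓘(ℝ, E) M) : ℝ :=
  g u.1 (Z u.1) u.2

theorem dProj_hField (X : Π x : M, TangentSpace 𝓘(ℝ, E) x) (u : TangentBundle 𝓘(ℝ, E) M) :
    dProj u (hField nabla X u) = X u.1 :=
  dProj_hLift nabla u _

theorem dProj_vField (X : Π x : M, TangentSpace 𝓘(ℝ, E) x) (u : TangentBundle 𝓘(ℝ, E) M) :
    dProj u (vField X u) = 0 :=
  dProj_vLift u _

namespace IsPseudoRiemannianMetric

theorem contMDiffAt_flatFun (hg : IsPseudoRiemannianMetric g) (hZ : CMDiffAt ∞ (T% Z) u.1) :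
    CMDiffAt ∞ (flatFun g Z) u := by
  have hπ := contMDiffAt_proj_tangentBundle u
  exact (contMDiffAt_totalSpace.1 (ContMDiffAt.clm_bundle_apply₂ (F₁ := E) (F₂ := E) (F₃ := ℝ)
    (E₃ := Bundle.Trivial M ℝ) (b := fun w : TangentBundle 𝓘(ℝ, E) M ↦ w.1)
    ((hg.contMDiff u.1).comp u hπ) (hZ.comp u hπ)
    (contMDiffAt_id (x := u) (I := 𝓘(ℝ, E).tangent)))).2

theorem mdifferentiableAt_flatFun (hg : IsPseudoRiemannianMetric g) (hZ : MDiffAt (T% Z) u.1) :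
    MDiffAt (flatFun g Z) u := by
  have hπ : MDiffAt (fun w : TangentBundle 𝓘(ℝ, E) M ↦ w.1) u :=
    mdifferentiableAt_proj (TangentSpace 𝓘(ℝ, E))
  have h := MDifferentiableAt.clm_bundle_apply₂ (F₁ := E) (F₂ := E) (F₃ := ℝ)
    (E₃ := Bundle.Trivial M ℝ) (b := fun w : TangentBundle 𝓘(ℝ, E) M ↦ w.1)
    (((hg.contMDiff u.1).mdifferentiableAt (by simp)).comp u hπ) (hZ.comp u hπ)
    (mdifferentiableAt_id (x := u) (I := 𝓘(ℝ, E).tangent))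
  rw [mdifferentiableAt_totalSpace] at h
  exact h.2

theorem mvfderiv_flatFun_vLift (hg : IsPseudoRiemannianMetric g) (hZ : MDiffAt (T% Z) u.1)
    (w : TangentSpace 𝓘(ℝ, E) u.1) : d% (flatFun g Z) u (vLift u w) = g u.1 (Z u.1) w := by
  rw [mvfderiv_vLift (hg.mdifferentiableAt_flatFun hZ)]
  let L : E →L[ℝ] ℝ := g u.1 (Z u.1)
  exact DFunLike.congr_fun (L.fderiv (x := u.2)) w

theorem mvfderiv_flatFun_hLift (hg : IsPseudoRiemannianMetric g) (hnabla : IsLeviCivita g nabla)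
    (hZ : MDiffAt (T% Z) u.1) (v : TangentSpace 𝓘(ℝ, E) u.1) :
    d% (flatFun g Z) u (hLift nabla u v) = g u.1 (nabla Z u.1 v) u.2 := by
  have hmetric := hnabla.metric (FiberBundle.extend E v) Z (FiberBundle.extend E u.2) u.1 hZ
    (FiberBundle.mdifferentiableAt_extend 𝓘(ℝ, E) E u.2)
  rw [FiberBundle.extend_apply_self, FiberBundle.extend_apply_self] at hmetric
  rw [mvfderiv_hLift (hg.mdifferentiableAt_flatFun hZ), hg.mvfderiv_flatFun_vLift hZ,
    sub_eq_iff_eq_add]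
  exact hmetric

theorem mvfderiv_flatFun_hField (hg : IsPseudoRiemannianMetric g) (hnabla : IsLeviCivita g nabla)
    (X : Π x : M, TangentSpace 𝓘(ℝ, E) x) (hZ : CMDiffAt ∞ (T% Z) u.1) :
    d% (flatFun g Z) u (hField nabla X u) = g u.1 (nabla Z u.1 (X u.1)) u.2 :=
  hg.mvfderiv_flatFun_hLift hnabla (hZ.mdifferentiableAt (by simp)) _

theorem mvfderiv_flatFun_vField (hg : IsPseudoRiemannianMetric g)
    (X : Π x : M, TangentSpace 𝓘(ℝ, E) x) (hZ : CMDiffAt ∞ (T% Z) u.1) :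
    d% (flatFun g Z) u (vField X u) = g u.1 (Z u.1) (X u.1) :=
  hg.mvfderiv_flatFun_vLift (hZ.mdifferentiableAt (by simp)) _

theorem mvfderiv_flatFun_hField_eventuallyEq (hg : IsPseudoRiemannianMetric g)
    (hnabla : IsLeviCivita g nabla) (X : Π x : M, TangentSpace 𝓘(ℝ, E) x)
    (hZ : CMDiffAt ∞ (T% Z) u.1) :
    (fun w ↦ d% (flatFun g Z) w (hField nabla X w))
      =ᶠ[𝓝 u] flatFun g (fun y ↦ nabla Z y (X y)) := by
  filter_upwards [(contMDiffAt_proj_tangentBundle u).continuousAt.eventually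
    (eventually_mdifferentiableAt_of_contMDiffAt hZ)] with w hw
  exact hg.mvfderiv_flatFun_hLift hnabla hw _

theorem mvfderiv_flatFun_vField_eventuallyEq (hg : IsPseudoRiemannianMetric g)
    (X : Π x : M, TangentSpace 𝓘(ℝ, E) x) (hZ : CMDiffAt ∞ (T% Z) u.1) :
    (fun w ↦ d% (flatFun g Z) w (vField X w)) =ᶠ[𝓝 u] fun w ↦ g w.1 (Z w.1) (X w.1) := by
  filter_upwards [(contMDiffAt_proj_tangentBundle u).continuousAt.eventually
    (eventually_mdifferentiableAt_of_contMDiffAt hZ)] with w hw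
  exact hg.mvfderiv_flatFun_vLift hw _

theorem eq_of_dProj_eq_of_mvfderiv_flatFun_eq [FiniteDimensional ℝ E]
    (hg : IsPseudoRiemannianMetric g)
    (nabla : CovariantDerivative 𝓘(ℝ, E) E (TangentSpace 𝓘(ℝ, E) : M → Type _))
    {ξ η : TangentSpace 𝓘(ℝ, E).tangent u} (hproj : dProj u ξ = dProj u η)
    (hflat : ∀ Z : Π x : M, TangentSpace 𝓘(ℝ, E) x, CMDiffAt ∞ (T% Z) u.1 →
      d% (flatFun g Z) u ξ = d% (flatFun g Z) u η) : ξ = η := by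
  rw [← hLift_hPart_add_vLift_vPart nabla ξ, ← hLift_hPart_add_vLift_vPart nabla η,
    hPart_eq_dProj, hPart_eq_dProj, hproj]
  congr 2
  refine hg.eq_of_forall_apply_eq fun z ↦ ?_
  let Z : Π x : M, TangentSpace 𝓘(ℝ, E) x := FiberBundle.extend E z
  have hZ : CMDiffAt ∞ (T% Z) u.1 := FiberBundle.contMDiffAt_extend 𝓘(ℝ, E) E z
  have h := hflat Z hZ
  rw [← hLift_hPart_add_vLift_vPart nabla ξ, ← hLift_hPart_add_vLift_vPart nabla η,
    hPart_eq_dProj, hPart_eq_dProj, hproj, map_add, map_add, add_right_inj,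
    hg.mvfderiv_flatFun_vLift (hZ.mdifferentiableAt (by simp)),
    hg.mvfderiv_flatFun_vLift (hZ.mdifferentiableAt (by simp)), hg.symm u.1 (Z u.1),
    hg.symm u.1 (Z u.1), show Z u.1 = z from FiberBundle.extend_apply_self E z] at h
  exact h

end IsPseudoRiemannianMetric

section LieBracketsOfLifts

theorem dProj_mlieBracket [CompleteSpace E]
    {A B : Π u : TangentBundle 𝓘(ℝ, E) M, TangentSpace 𝓘(ℝ, E).tangent u}
    (hA : CMDiffAt ∞ (T% A) u) (hB : CMDiffAt ∞ (T% B) u)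
    (hX : CMDiffAt ∞ (T% X) u.1) (hY : CMDiffAt ∞ (T% Y) u.1)
    (hAX : ∀ w, dProj w (A w) = X w.1) (hBY : ∀ w, dProj w (B w) = Y w.1) :
    dProj u (mlieBracket 𝓘(ℝ, E).tangent A B u) = mlieBracket 𝓘(ℝ, E) X Y u.1 := by
  refine eq_of_forall_mvfderiv_eq fun f hf ↦ ?_
  have hπ := contMDiffAt_proj_tangentBundle u
  have hlift {C : Π u : TangentBundle 𝓘(ℝ, E) M, TangentSpace 𝓘(ℝ, E).tangent u}
      {W : Π x : M, TangentSpace 𝓘(ℝ, E) x} (hCW : ∀ w, dProj w (C w) = W w.1) :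
      (fun w ↦ d% (fun w : TangentBundle 𝓘(ℝ, E) M ↦ f w.1) w (C w))
        =ᶠ[𝓝 u] fun w ↦ d% f w.1 (W w.1) :=
    (hπ.continuousAt.eventually (eventually_mdifferentiableAt_of_contMDiffAt hf)).mono
      fun w hw ↦ (mvfderiv_comp_proj hw _).trans (by rw [hCW])
  rw [← mvfderiv_comp_proj (hf.mdifferentiableAt (by simp)),
    mvfderiv_mlieBracket (f := fun w : TangentBundle 𝓘(ℝ, E) M ↦ f w.1) (hf.comp u hπ) hA hB,
    mvfderiv_mlieBracket hf hX hY, mvfderiv_congr (hlift hAX), mvfderiv_congr (hlift hBY),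
    mvfderiv_comp_proj (f := fun y ↦ d% f y (Y y))
      ((contMDiffAt_mvfderiv_vectorField hf hY).mdifferentiableAt (by simp)),
    mvfderiv_comp_proj (f := fun y ↦ d% f y (X y))
      ((contMDiffAt_mvfderiv_vectorField hf hX).mdifferentiableAt (by simp)), hAX, hBY]

variable [FiniteDimensional ℝ E]

theorem mlieBracket_hField_hField (hg : IsPseudoRiemannianMetric g)
    (hnabla : IsLeviCivita g nabla) (hX : CMDiffAt ∞ (T% X) u.1) (hY : CMDiffAt ∞ (T% Y) u.1)
    (hU : CMDiffAt ∞ (T% U) u.1) (hUu : U u.1 = u.2) :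
    mlieBracket 𝓘(ℝ, E).tangent (hField nabla X) (hField nabla Y) u
      = hLift nabla u (mlieBracket 𝓘(ℝ, E) X Y u.1) - vLift u (curvatureOp nabla X Y U u.1) := by
  have : CompleteSpace E := FiniteDimensional.complete ℝ E
  have hXH := contMDiffAt_hField hnabla.smooth hX
  have hYH := contMDiffAt_hField hnabla.smooth hY
  refine hg.eq_of_dProj_eq_of_mvfderiv_flatFun_eq nabla ?_ fun Z hZ ↦ ?_
  · rw [dProj_mlieBracket hXH hYH hX hY (dProj_hField X) (dProj_hField Y), map_sub, dProj_hLift,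
      dProj_vLift, sub_zero]
  have hXZ := hnabla.smooth X Z u.1 hX hZ
  have hYZ := hnabla.smooth Y Z u.1 hY hZ
  have hskew := hnabla.curvatureForm_swap_right hg hX hY hU hZ
  rw [mvfderiv_mlieBracket (hg.contMDiffAt_flatFun hZ) hXH hYH,
    mvfderiv_congr (hg.mvfderiv_flatFun_hField_eventuallyEq hnabla X hZ),
    mvfderiv_congr (hg.mvfderiv_flatFun_hField_eventuallyEq hnabla Y hZ),
    hg.mvfderiv_flatFun_hField hnabla X hYZ,
    hg.mvfderiv_flatFun_hField hnabla Y hXZ, map_sub,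
    hg.mvfderiv_flatFun_hLift hnabla (hZ.mdifferentiableAt (by simp)),
    hg.mvfderiv_flatFun_vLift (hZ.mdifferentiableAt (by simp)), hg.symm u.1 (Z u.1)]
  simp only [curvatureForm, curvatureOp, hUu, map_sub, sub_apply] at hskew ⊢
  linarith

theorem mlieBracket_hField_vField (hg : IsPseudoRiemannianMetric g)
    (hnabla : IsLeviCivita g nabla) (hX : CMDiffAt ∞ (T% X) u.1) (hY : CMDiffAt ∞ (T% Y) u.1) :
    mlieBracket 𝓘(ℝ, E).tangent (hField nabla X) (vField Y) u
      = vLift u (nabla Y u.1 (X u.1)) := by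
  have : CompleteSpace E := FiniteDimensional.complete ℝ E
  have hXH := contMDiffAt_hField hnabla.smooth hX
  have hYV := contMDiffAt_vField hY
  refine hg.eq_of_dProj_eq_of_mvfderiv_flatFun_eq nabla ?_ fun Z hZ ↦ ?_
  · rw [dProj_mlieBracket hXH hYV hX (contMDiffAt_zeroSection ℝ _) (dProj_hField X)
      (dProj_vField Y), dProj_vLift]
    exact congrFun mlieBracket_zero_right u.1
  have hZd := hZ.mdifferentiableAt (n := ∞) (by simp)
  rw [mvfderiv_mlieBracket (hg.contMDiffAt_flatFun hZ) hXH hYV,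
    mvfderiv_congr (hg.mvfderiv_flatFun_hField_eventuallyEq hnabla X hZ),
    mvfderiv_congr (hg.mvfderiv_flatFun_vField_eventuallyEq Y hZ),
    hg.mvfderiv_flatFun_vField Y (hnabla.smooth X Z u.1 hX hZ),
    hg.mvfderiv_flatFun_vLift hZd,
    mvfderiv_comp_proj (f := fun y ↦ g y (Z y) (Y y))
      ((hg.contMDiffAt_apply hZ hY).mdifferentiableAt (by simp)),
    dProj_hField, hnabla.metric X Z Y u.1 hZd (hY.mdifferentiableAt (by simp))]
  exact add_sub_cancel_left _ _

theorem mlieBracket_vField_vField (hg : IsPseudoRiemannianMetric g)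
    (nabla : CovariantDerivative 𝓘(ℝ, E) E (TangentSpace 𝓘(ℝ, E) : M → Type _))
    (hX : CMDiffAt ∞ (T% X) u.1) (hY : CMDiffAt ∞ (T% Y) u.1) :
    mlieBracket 𝓘(ℝ, E).tangent (vField X) (vField Y) u = 0 := by
  have : CompleteSpace E := FiniteDimensional.complete ℝ E
  have hXV := contMDiffAt_vField hX
  have hYV := contMDiffAt_vField hY
  refine hg.eq_of_dProj_eq_of_mvfderiv_flatFun_eq nabla ?_ fun Z hZ ↦ ?_
  · rw [dProj_mlieBracket hXV hYV (contMDiffAt_zeroSection ℝ _) (contMDiffAt_zeroSection ℝ _)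
      (dProj_vField X) (dProj_vField Y), map_zero]
    exact congrFun mlieBracket_zero_right u.1
  rw [mvfderiv_mlieBracket (hg.contMDiffAt_flatFun hZ) hXV hYV,
    mvfderiv_congr (hg.mvfderiv_flatFun_vField_eventuallyEq X hZ),
    mvfderiv_congr (hg.mvfderiv_flatFun_vField_eventuallyEq Y hZ),
    mvfderiv_comp_proj (f := fun y ↦ g y (Z y) (Y y))
      ((hg.contMDiffAt_apply hZ hY).mdifferentiableAt (by simp)),
    mvfderiv_comp_proj (f := fun y ↦ g y (Z y) (X y))
      ((hg.contMDiffAt_apply hZ hX).mdifferentiableAt (by simp)), dProj_vField, dProj_vField]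
  simp

end LieBracketsOfLifts

end FiberwiseLinearFunctions

section CompleteLift

variable {E : Type*} [NormedAddCommGroup E] [NormedSpace ℝ E] [FiniteDimensional ℝ E]
  {M : Type*} [TopologicalSpace M] [ChartedSpace E M] [IsManifold 𝓘(ℝ, E) ∞ M]
  {g : Π x : M, TangentSpace 𝓘(ℝ, E) x →L[ℝ] TangentSpace 𝓘(ℝ, E) x →L[ℝ] ℝ}
  {nabla : CovariantDerivative 𝓘(ℝ, E) E (TangentSpace 𝓘(ℝ, E) : M → Type _)}
  {X Y Z U : Π x : M, TangentSpace 𝓘(ℝ, E) x} {u : TangentBundle 𝓘(ℝ, E) M}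

theorem completeLift_apply (ξ η : TangentSpace 𝓘(ℝ, E).tangent u) :
    completeLift g nabla u ξ η = g u.1 (hPart nabla u ξ) (vPart nabla u η)
      + g u.1 (vPart nabla u ξ) (hPart nabla u η) :=
  rfl

theorem completeLift_hLift_right (ξ : TangentSpace 𝓘(ℝ, E).tangent u)
    (z : TangentSpace 𝓘(ℝ, E) u.1) :
    completeLift g nabla u ξ (hLift nabla u z) = g u.1 (vPart nabla u ξ) z := by
  rw [completeLift_apply, hPart_hLift, vPart_hLift, map_zero, zero_add]

theorem completeLift_vLift_right (ξ : TangentSpace 𝓘(ℝ, E).tangent u)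
    (z : TangentSpace 𝓘(ℝ, E) u.1) :
    completeLift g nabla u ξ (vLift u z) = g u.1 (hPart nabla u ξ) z := by
  rw [completeLift_apply, hPart_vLift, vPart_vLift, map_zero, add_zero]

theorem completeLift_hLift_hLift (x y : TangentSpace 𝓘(ℝ, E) u.1) :
    completeLift g nabla u (hLift nabla u x) (hLift nabla u y) = 0 := by
  rw [completeLift_hLift_right, vPart_hLift, map_zero, zero_apply]

theorem completeLift_hLift_vLift (x y : TangentSpace 𝓘(ℝ, E) u.1) :
    completeLift g nabla u (hLift nabla u x) (vLift u y) = g u.1 x y := by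
  rw [completeLift_vLift_right, hPart_hLift]

theorem completeLift_vLift_hLift (x y : TangentSpace 𝓘(ℝ, E) u.1) :
    completeLift g nabla u (vLift u x) (hLift nabla u y) = g u.1 x y := by
  rw [completeLift_hLift_right, vPart_vLift]

theorem completeLift_vLift_vLift (x y : TangentSpace 𝓘(ℝ, E) u.1) :
    completeLift g nabla u (vLift u x) (vLift u y) = 0 := by
  rw [completeLift_vLift_right, hPart_vLift, map_zero, zero_apply]

theorem mvfderiv_completeLift_hField_hField (X Y : Π x : M, TangentSpace 𝓘(ℝ, E) x)
    (ξ : TangentSpace 𝓘(ℝ, E).tangent u) :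
    d% (fun w ↦ completeLift g nabla w (hField nabla X w) (hField nabla Y w)) u ξ = 0 := by
  simp only [hField, completeLift_hLift_hLift, mvfderiv_const, zero_apply]

theorem mvfderiv_completeLift_vField_vField (X Y : Π x : M, TangentSpace 𝓘(ℝ, E) x)
    (ξ : TangentSpace 𝓘(ℝ, E).tangent u) :
    d% (fun w ↦ completeLift g nabla w (vField X w) (vField Y w)) u ξ = 0 := by
  simp only [vField, completeLift_vLift_vLift, mvfderiv_const, zero_apply]

namespace IsPseudoRiemannianMetric

theorem completeLift_symm (hg : IsPseudoRiemannianMetric g)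
    (nabla : CovariantDerivative 𝓘(ℝ, E) E (TangentSpace 𝓘(ℝ, E) : M → Type _))
    (u : TangentBundle 𝓘(ℝ, E) M) (ξ η : TangentSpace 𝓘(ℝ, E).tangent u) :
    completeLift g nabla u ξ η = completeLift g nabla u η ξ := by
  rw [completeLift_apply, completeLift_apply, hg.symm u.1 (hPart nabla u ξ),
    hg.symm u.1 (vPart nabla u ξ), add_comm]

theorem eq_of_forall_completeLift_eq (hg : IsPseudoRiemannianMetric g)
    {ξ η : TangentSpace 𝓘(ℝ, E).tangent u}
    (hH : ∀ Z : Π x : M, TangentSpace 𝓘(ℝ, E) x, CMDiffAt ∞ (T% Z) u.1 →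
      completeLift g nabla u ξ (hField nabla Z u) = completeLift g nabla u η (hField nabla Z u))
    (hV : ∀ Z : Π x : M, TangentSpace 𝓘(ℝ, E) x, CMDiffAt ∞ (T% Z) u.1 →
      completeLift g nabla u ξ (vField Z u) = completeLift g nabla u η (vField Z u)) :
    ξ = η := by
  have hextend (z : TangentSpace 𝓘(ℝ, E) u.1) : CMDiffAt ∞ (T% (FiberBundle.extend E z)) u.1 :=
    FiberBundle.contMDiffAt_extend 𝓘(ℝ, E) E z
  have hpart : hPart nabla u ξ = hPart nabla u η := hg.eq_of_forall_apply_eq fun z ↦ by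
    simpa only [vField, FiberBundle.extend_apply_self, completeLift_vLift_right]
      using hV _ (hextend z)
  have vpart : vPart nabla u ξ = vPart nabla u η := hg.eq_of_forall_apply_eq fun z ↦ by
    simpa only [hField, FiberBundle.extend_apply_self, completeLift_hLift_right]
      using hH _ (hextend z)
  rw [← hLift_hPart_add_vLift_vPart nabla ξ, hpart, vpart, hLift_hPart_add_vLift_vPart]

theorem mvfderiv_completeLift_hField_vField (hg : IsPseudoRiemannianMetric g)
    (hX : CMDiffAt ∞ (T% X) u.1) (hY : CMDiffAt ∞ (T% Y) u.1)
    (ξ : TangentSpace 𝓘(ℝ, E).tangent u) :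
    d% (fun w ↦ completeLift g nabla w (hField nabla X w) (vField Y w)) u ξ
      = d% (fun y ↦ g y (X y) (Y y)) u.1 (dProj u ξ) := by
  simp only [hField, vField, completeLift_hLift_vLift]
  exact mvfderiv_comp_proj (f := fun y ↦ g y (X y) (Y y))
    ((hg.contMDiffAt_apply hX hY).mdifferentiableAt (by simp)) ξ

theorem mvfderiv_completeLift_vField_hField (hg : IsPseudoRiemannianMetric g)
    (hX : CMDiffAt ∞ (T% X) u.1) (hY : CMDiffAt ∞ (T% Y) u.1)
    (ξ : TangentSpace 𝓘(ℝ, E).tangent u) :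
    d% (fun w ↦ completeLift g nabla w (vField X w) (hField nabla Y w)) u ξ
      = d% (fun y ↦ g y (X y) (Y y)) u.1 (dProj u ξ) := by
  simp only [hField, vField, completeLift_vLift_hLift]
  exact mvfderiv_comp_proj (f := fun y ↦ g y (X y) (Y y))
    ((hg.contMDiffAt_apply hX hY).mdifferentiableAt (by simp)) ξ

end IsPseudoRiemannianMetric

section LeviCivitaConnection

variable {nablaHat : CovariantDerivative 𝓘(ℝ, E).tangent (E × E)
    (TangentSpace 𝓘(ℝ, E).tangent : TangentBundle 𝓘(ℝ, E) M → Type _)}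

theorem mdifferentiableAt_hField (hnabla : IsLeviCivita g nabla) (hX : CMDiffAt ∞ (T% X) u.1) :
    MDiffAt (T% (hField nabla X)) u :=
  (contMDiffAt_hField hnabla.smooth hX).mdifferentiableAt (by simp)

theorem completeLift_leviCivita_vField_vField (hg : IsPseudoRiemannianMetric g)
    (hnabla : IsLeviCivita g nabla) (hhat : IsLeviCivita (completeLift g nabla) nablaHat)
    (hX : CMDiffAt ∞ (T% X) u.1) (hY : CMDiffAt ∞ (T% Y) u.1) :
    nablaHat (vField Y) u (vField X u) = 0 := by
  have hXV := mdifferentiableAt_vField (u := u) hX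
  have hYV := mdifferentiableAt_vField (u := u) hY
  refine hg.eq_of_forall_completeLift_eq (nabla := nabla) (fun Z hZ ↦ ?_) fun Z hZ ↦ ?_
  · have h := hhat.koszul (hg.completeLift_symm nabla) hXV hYV (mdifferentiableAt_hField hnabla hZ)
    rw [hg.mvfderiv_completeLift_vField_hField hY hZ, hg.mvfderiv_completeLift_vField_hField hX hZ,
      mvfderiv_completeLift_vField_vField, mlieBracket_vField_vField hg nabla hX hY,
      mlieBracket_swap_apply (V := vField X), mlieBracket_hField_vField hg hnabla hZ hX,
      mlieBracket_swap_apply (V := vField Y), mlieBracket_hField_vField hg hnabla hZ hY] at h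
    simp only [vField, dProj_vLift, completeLift_vLift_vLift, map_neg, map_zero, zero_apply,
      neg_apply] at h ⊢
    linarith
  · have h := hhat.koszul (hg.completeLift_symm nabla) hXV hYV (mdifferentiableAt_vField hZ)
    simp only [mvfderiv_completeLift_vField_vField, mlieBracket_vField_vField hg nabla hX hY,
      mlieBracket_vField_vField hg nabla hX hZ, mlieBracket_vField_vField hg nabla hY hZ, map_zero,
      zero_apply] at h ⊢
    linarith

theorem completeLift_leviCivita_hField_vField (hg : IsPseudoRiemannianMetric g)
    (hnabla : IsLeviCivita g nabla) (hhat : IsLeviCivita (completeLift g nabla) nablaHat)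
    (hX : CMDiffAt ∞ (T% X) u.1) (hY : CMDiffAt ∞ (T% Y) u.1) :
    nablaHat (vField Y) u (hField nabla X u) = vLift u (nabla Y u.1 (X u.1)) := by
  have : CompleteSpace E := FiniteDimensional.complete ℝ E
  have hXH := mdifferentiableAt_hField hnabla hX
  have hYV := mdifferentiableAt_vField (u := u) hY
  refine hg.eq_of_forall_completeLift_eq (nabla := nabla) (fun Z hZ ↦ ?_) fun Z hZ ↦ ?_
  · have h := hhat.koszul (hg.completeLift_symm nabla) hXH hYV (mdifferentiableAt_hField hnabla hZ)
    rw [hg.mvfderiv_completeLift_vField_hField hY hZ, mvfderiv_completeLift_hField_hField,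
      hg.mvfderiv_completeLift_hField_vField hX hY, mlieBracket_hField_vField hg hnabla hX hY,
      mlieBracket_hField_hField hg hnabla hX hZ (FiberBundle.contMDiffAt_extend 𝓘(ℝ, E) E u.2)
        (FiberBundle.extend_apply_self E u.2),
      mlieBracket_swap_apply (V := vField Y), mlieBracket_hField_vField hg hnabla hZ hY] at h
    simp only [hField, vField, dProj_hLift, completeLift_vLift_vLift, completeLift_vLift_hLift,
      completeLift_hLift_vLift, map_neg, map_sub, neg_apply, sub_apply] at h ⊢
    have hZ' := hZ.mdifferentiableAt (n := ∞) (by simp)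
    have hX' := hX.mdifferentiableAt (n := ∞) (by simp)
    have hY' := hY.mdifferentiableAt (n := ∞) (by simp)
    rw [hnabla.metric X Y Z u.1 hY' hZ', hnabla.metric Z X Y u.1 hX' hY',
      ← hnabla.torsion_free X Z u.1 hX' hZ', map_sub, sub_apply, hg.symm u.1 (Y u.1),
      hg.symm u.1 (X u.1)] at h
    linarith
  · have h := hhat.koszul (hg.completeLift_symm nabla) hXH hYV (mdifferentiableAt_vField hZ)
    rw [mvfderiv_completeLift_vField_vField, hg.mvfderiv_completeLift_hField_vField hX hZ,
      hg.mvfderiv_completeLift_hField_vField hX hY, mlieBracket_hField_vField hg hnabla hX hY,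
      mlieBracket_hField_vField hg hnabla hX hZ, mlieBracket_vField_vField hg nabla hY hZ] at h
    simp only [vField, dProj_vLift, completeLift_vLift_vLift, map_zero, zero_apply] at h ⊢
    linarith

theorem completeLift_leviCivita_vField_hField (hg : IsPseudoRiemannianMetric g)
    (hnabla : IsLeviCivita g nabla) (hhat : IsLeviCivita (completeLift g nabla) nablaHat)
    (hX : CMDiffAt ∞ (T% X) u.1) (hY : CMDiffAt ∞ (T% Y) u.1) :
    nablaHat (hField nabla Y) u (vField X u) = 0 := by
  have htorsion := hhat.torsion_free (hField nabla Y) (vField X) u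
    (mdifferentiableAt_hField hnabla hY) (mdifferentiableAt_vField hX)
  rwa [completeLift_leviCivita_hField_vField hg hnabla hhat hY hX,
    mlieBracket_hField_vField hg hnabla hY hX, sub_eq_self] at htorsion

theorem completeLift_leviCivita_hField_hField (hg : IsPseudoRiemannianMetric g)
    (hnabla : IsLeviCivita g nabla) (hhat : IsLeviCivita (completeLift g nabla) nablaHat)
    (hX : CMDiffAt ∞ (T% X) u.1) (hY : CMDiffAt ∞ (T% Y) u.1) (hU : CMDiffAt ∞ (T% U) u.1)
    (hUu : U u.1 = u.2) :
    nablaHat (hField nabla Y) u (hField nabla X u)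
      = hLift nabla u (nabla Y u.1 (X u.1)) + vLift u (curvatureOp nabla U X Y u.1) := by
  have : CompleteSpace E := FiniteDimensional.complete ℝ E
  have hXH := mdifferentiableAt_hField hnabla hX
  have hYH := mdifferentiableAt_hField hnabla hY
  refine hg.eq_of_forall_completeLift_eq (nabla := nabla) (fun Z hZ ↦ ?_) fun Z hZ ↦ ?_
  · have h := hhat.koszul (hg.completeLift_symm nabla) hXH hYH (mdifferentiableAt_hField hnabla hZ)
    simp only [mvfderiv_completeLift_hField_hField,
      mlieBracket_hField_hField hg hnabla hX hY hU hUu,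
      mlieBracket_hField_hField hg hnabla hX hZ hU hUu,
      mlieBracket_hField_hField hg hnabla hY hZ hU hUu] at h
    have hcurvature := hnabla.two_mul_curvatureForm_eq hg hU hX hY hZ
    simp only [curvatureForm] at hcurvature
    simp only [hField, completeLift_hLift_hLift, completeLift_vLift_hLift,
      map_add, map_sub, add_apply, sub_apply] at h ⊢
    linarith
  · have hmetric := hhat.metric (hField nabla X) (hField nabla Y) (vField Z) u hYH
      (mdifferentiableAt_vField hZ)
    rw [hg.mvfderiv_completeLift_hField_vField hY hZ, dProj_hField,
      hnabla.metric X Y Z u.1 (hY.mdifferentiableAt (by simp)) (hZ.mdifferentiableAt (by simp)),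
      completeLift_leviCivita_hField_vField hg hnabla hhat hX hZ] at hmetric
    simp only [hField, vField, completeLift_hLift_vLift, completeLift_vLift_vLift, map_add,
      add_apply, add_zero, add_left_inj] at hmetric ⊢
    exact hmetric.symm

end LeviCivitaConnection

end CompleteLift

/-- The vector field `(∇_X J)Y = ∇_X (JY) - J(∇_X Y)`, whose metric dual is the structure tensor
of `J`. -/
noncomputable def covDerivEndomorphism {E : Type*} [NormedAddCommGroup E] [NormedSpace ℝ E]
    {H : Type*} [TopologicalSpace H] {I : ModelWithCorners ℝ E H}
    {M : Type*} [TopologicalSpace M] [ChartedSpace H M] [IsManifold I 1 M]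
    (cov : CovariantDerivative I E (TangentSpace I : M → Type _))
    (J : Π x : M, TangentSpace I x →L[ℝ] TangentSpace I x)
    (X Y : Π x : M, TangentSpace I x) (x : M) : TangentSpace I x :=
  cov (fun y ↦ J y (Y y)) x (X x) - J x (cov Y x (X x))

section LiftedStructures

variable {E : Type*} [NormedAddCommGroup E] [NormedSpace ℝ E] [FiniteDimensional ℝ E]
  {M : Type*} [TopologicalSpace M] [ChartedSpace E M] [IsManifold 𝓘(ℝ, E) ∞ M]

section Lifts

variable (nabla : CovariantDerivative 𝓘(ℝ, E) E (TangentSpace 𝓘(ℝ, E) : M → Type _))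
  (J : Π x : M, TangentSpace 𝓘(ℝ, E) x →L[ℝ] TangentSpace 𝓘(ℝ, E) x)
  {u : TangentBundle 𝓘(ℝ, E) M} (x : TangentSpace 𝓘(ℝ, E) u.1)

theorem J1_hLift : J1 nabla J u (hLift nabla u x) = -hLift nabla u (J u.1 x) := by
  simp [J1, hPart_hLift, vPart_hLift]

theorem J1_vLift : J1 nabla J u (vLift u x) = vLift u (J u.1 x) := by
  simp [J1, hPart_vLift, vPart_vLift]

theorem J2_hLift : J2 nabla u (hLift nabla u x) = vLift u x := by
  simp [J2, hPart_hLift, vPart_hLift]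

theorem J2_vLift : J2 nabla u (vLift u x) = -hLift nabla u x := by
  simp [J2, hPart_vLift, vPart_vLift]

theorem J3_hLift : J3 nabla J u (hLift nabla u x) = vLift u (J u.1 x) := by
  simp [J3, hPart_hLift, vPart_hLift]

theorem J3_vLift : J3 nabla J u (vLift u x) = hLift nabla u (J u.1 x) := by
  simp [J3, hPart_vLift, vPart_vLift]

variable (Y : Π x : M, TangentSpace 𝓘(ℝ, E) x)

theorem J1_hField : (fun w ↦ J1 nabla J w (hField nabla Y w))
    = fun w ↦ -hField nabla (fun x ↦ J x (Y x)) w :=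
  funext fun w ↦ J1_hLift nabla J (Y w.1)

theorem J1_vField : (fun w ↦ J1 nabla J w (vField Y w)) = vField fun x ↦ J x (Y x) :=
  funext fun w ↦ J1_vLift nabla J (Y w.1)

theorem J2_hField : (fun w ↦ J2 nabla w (hField nabla Y w)) = vField Y :=
  funext fun w ↦ J2_hLift nabla (Y w.1)

theorem J2_vField : (fun w ↦ J2 nabla w (vField Y w)) = fun w ↦ -hField nabla Y w :=
  funext fun w ↦ J2_vLift nabla (Y w.1)

theorem J3_hField : (fun w ↦ J3 nabla J w (hField nabla Y w)) = vField fun x ↦ J x (Y x) :=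
  funext fun w ↦ J3_hLift nabla J (Y w.1)

theorem J3_vField : (fun w ↦ J3 nabla J w (vField Y w)) = hField nabla fun x ↦ J x (Y x) :=
  funext fun w ↦ J3_vLift nabla J (Y w.1)

end Lifts

variable {g : Π x : M, TangentSpace 𝓘(ℝ, E) x →L[ℝ] TangentSpace 𝓘(ℝ, E) x →L[ℝ] ℝ}
  {nabla : CovariantDerivative 𝓘(ℝ, E) E (TangentSpace 𝓘(ℝ, E) : M → Type _)}
  {nablaHat : CovariantDerivative 𝓘(ℝ, E).tangent (E × E)
    (TangentSpace 𝓘(ℝ, E).tangent : TangentBundle 𝓘(ℝ, E) M → Type _)}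
  {J : Π x : M, TangentSpace 𝓘(ℝ, E) x →L[ℝ] TangentSpace 𝓘(ℝ, E) x}
  {X Y U : Π x : M, TangentSpace 𝓘(ℝ, E) x} {u : TangentBundle 𝓘(ℝ, E) M}

theorem covDerivEndomorphism_J1_hField_hField (hg : IsPseudoRiemannianMetric g)
    (hnabla : IsLeviCivita g nabla) (hhat : IsLeviCivita (completeLift g nabla) nablaHat)
    (hX : CMDiffAt ∞ (T% X) u.1) (hY : CMDiffAt ∞ (T% Y) u.1)
    (hJY : CMDiffAt ∞ (T% fun x ↦ J x (Y x)) u.1) (hU : CMDiffAt ∞ (T% U) u.1)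
    (hUu : U u.1 = u.2) :
    covDerivEndomorphism nablaHat (J1 nabla J) (hField nabla X) (hField nabla Y) u
      = -hLift nabla u (covDerivEndomorphism nabla J X Y u.1)
        - vLift u (curvatureOp nabla U X (fun x ↦ J x (Y x)) u.1
          + J u.1 (curvatureOp nabla U X Y u.1)) := by
  rw [covDerivEndomorphism, J1_hField,
    covariantDerivative_neg nablaHat (mdifferentiableAt_hField hnabla hJY),
    completeLift_leviCivita_hField_hField hg hnabla hhat hX hJY hU hUu,
    completeLift_leviCivita_hField_hField hg hnabla hhat hX hY hU hUu, map_add, J1_hLift, J1_vLift,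
    covDerivEndomorphism, map_sub, map_add]
  abel

theorem covDerivEndomorphism_J1_hField_vField (hg : IsPseudoRiemannianMetric g)
    (hnabla : IsLeviCivita g nabla) (hhat : IsLeviCivita (completeLift g nabla) nablaHat)
    (hX : CMDiffAt ∞ (T% X) u.1) (hY : CMDiffAt ∞ (T% Y) u.1)
    (hJY : CMDiffAt ∞ (T% fun x ↦ J x (Y x)) u.1) :
    covDerivEndomorphism nablaHat (J1 nabla J) (hField nabla X) (vField Y) u
      = vLift u (covDerivEndomorphism nabla J X Y u.1) := by
  rw [covDerivEndomorphism, J1_vField, completeLift_leviCivita_hField_vField hg hnabla hhat hX hJY,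
    completeLift_leviCivita_hField_vField hg hnabla hhat hX hY, J1_vLift, ← map_sub,
    covDerivEndomorphism]

theorem covDerivEndomorphism_J1_vField_hField (hg : IsPseudoRiemannianMetric g)
    (hnabla : IsLeviCivita g nabla) (hhat : IsLeviCivita (completeLift g nabla) nablaHat)
    (hX : CMDiffAt ∞ (T% X) u.1) (hY : CMDiffAt ∞ (T% Y) u.1)
    (hJY : CMDiffAt ∞ (T% fun x ↦ J x (Y x)) u.1) :
    covDerivEndomorphism nablaHat (J1 nabla J) (vField X) (hField nabla Y) u = 0 := by
  rw [covDerivEndomorphism, J1_hField,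
    covariantDerivative_neg nablaHat (mdifferentiableAt_hField hnabla hJY),
    completeLift_leviCivita_vField_hField hg hnabla hhat hX hJY,
    completeLift_leviCivita_vField_hField hg hnabla hhat hX hY, map_zero, neg_zero, sub_zero]

theorem covDerivEndomorphism_J1_vField_vField (hg : IsPseudoRiemannianMetric g)
    (hnabla : IsLeviCivita g nabla) (hhat : IsLeviCivita (completeLift g nabla) nablaHat)
    (hX : CMDiffAt ∞ (T% X) u.1) (hY : CMDiffAt ∞ (T% Y) u.1)
    (hJY : CMDiffAt ∞ (T% fun x ↦ J x (Y x)) u.1) :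
    covDerivEndomorphism nablaHat (J1 nabla J) (vField X) (vField Y) u = 0 := by
  rw [covDerivEndomorphism, J1_vField, completeLift_leviCivita_vField_vField hg hnabla hhat hX hJY,
    completeLift_leviCivita_vField_vField hg hnabla hhat hX hY, map_zero, sub_zero]

theorem covDerivEndomorphism_J2_hField_hField (hg : IsPseudoRiemannianMetric g)
    (hnabla : IsLeviCivita g nabla) (hhat : IsLeviCivita (completeLift g nabla) nablaHat)
    (hX : CMDiffAt ∞ (T% X) u.1) (hY : CMDiffAt ∞ (T% Y) u.1) (hU : CMDiffAt ∞ (T% U) u.1)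
    (hUu : U u.1 = u.2) :
    covDerivEndomorphism nablaHat (J2 nabla) (hField nabla X) (hField nabla Y) u
      = hLift nabla u (curvatureOp nabla U X Y u.1) := by
  rw [covDerivEndomorphism, J2_hField, completeLift_leviCivita_hField_vField hg hnabla hhat hX hY,
    completeLift_leviCivita_hField_hField hg hnabla hhat hX hY hU hUu, map_add, J2_hLift, J2_vLift]
  abel

theorem covDerivEndomorphism_J2_hField_vField (hg : IsPseudoRiemannianMetric g)
    (hnabla : IsLeviCivita g nabla) (hhat : IsLeviCivita (completeLift g nabla) nablaHat)
    (hX : CMDiffAt ∞ (T% X) u.1) (hY : CMDiffAt ∞ (T% Y) u.1) (hU : CMDiffAt ∞ (T% U) u.1)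
    (hUu : U u.1 = u.2) :
    covDerivEndomorphism nablaHat (J2 nabla) (hField nabla X) (vField Y) u
      = -vLift u (curvatureOp nabla U X Y u.1) := by
  rw [covDerivEndomorphism, J2_vField,
    covariantDerivative_neg nablaHat (mdifferentiableAt_hField hnabla hY),
    completeLift_leviCivita_hField_hField hg hnabla hhat hX hY hU hUu,
    completeLift_leviCivita_hField_vField hg hnabla hhat hX hY, J2_vLift]
  abel

theorem covDerivEndomorphism_J2_vField_hField (hg : IsPseudoRiemannianMetric g)
    (hnabla : IsLeviCivita g nabla) (hhat : IsLeviCivita (completeLift g nabla) nablaHat)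
    (hX : CMDiffAt ∞ (T% X) u.1) (hY : CMDiffAt ∞ (T% Y) u.1) :
    covDerivEndomorphism nablaHat (J2 nabla) (vField X) (hField nabla Y) u = 0 := by
  rw [covDerivEndomorphism, J2_hField, completeLift_leviCivita_vField_vField hg hnabla hhat hX hY,
    completeLift_leviCivita_vField_hField hg hnabla hhat hX hY, map_zero, sub_zero]

theorem covDerivEndomorphism_J2_vField_vField (hg : IsPseudoRiemannianMetric g)
    (hnabla : IsLeviCivita g nabla) (hhat : IsLeviCivita (completeLift g nabla) nablaHat)
    (hX : CMDiffAt ∞ (T% X) u.1) (hY : CMDiffAt ∞ (T% Y) u.1) :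
    covDerivEndomorphism nablaHat (J2 nabla) (vField X) (vField Y) u = 0 := by
  rw [covDerivEndomorphism, J2_vField,
    covariantDerivative_neg nablaHat (mdifferentiableAt_hField hnabla hY),
    completeLift_leviCivita_vField_hField hg hnabla hhat hX hY,
    completeLift_leviCivita_vField_vField hg hnabla hhat hX hY, map_zero, neg_zero, sub_zero]

theorem covDerivEndomorphism_J3_hField_hField (hg : IsPseudoRiemannianMetric g)
    (hnabla : IsLeviCivita g nabla) (hhat : IsLeviCivita (completeLift g nabla) nablaHat)
    (hX : CMDiffAt ∞ (T% X) u.1) (hY : CMDiffAt ∞ (T% Y) u.1)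
    (hJY : CMDiffAt ∞ (T% fun x ↦ J x (Y x)) u.1) (hU : CMDiffAt ∞ (T% U) u.1)
    (hUu : U u.1 = u.2) :
    covDerivEndomorphism nablaHat (J3 nabla J) (hField nabla X) (hField nabla Y) u
      = vLift u (covDerivEndomorphism nabla J X Y u.1)
        - hLift nabla u (J u.1 (curvatureOp nabla U X Y u.1)) := by
  rw [covDerivEndomorphism, J3_hField, completeLift_leviCivita_hField_vField hg hnabla hhat hX hJY,
    completeLift_leviCivita_hField_hField hg hnabla hhat hX hY hU hUu, map_add, J3_hLift, J3_vLift,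
    covDerivEndomorphism, map_sub]
  abel

theorem covDerivEndomorphism_J3_hField_vField (hg : IsPseudoRiemannianMetric g)
    (hnabla : IsLeviCivita g nabla) (hhat : IsLeviCivita (completeLift g nabla) nablaHat)
    (hX : CMDiffAt ∞ (T% X) u.1) (hY : CMDiffAt ∞ (T% Y) u.1)
    (hJY : CMDiffAt ∞ (T% fun x ↦ J x (Y x)) u.1) (hU : CMDiffAt ∞ (T% U) u.1)
    (hUu : U u.1 = u.2) :
    covDerivEndomorphism nablaHat (J3 nabla J) (hField nabla X) (vField Y) u
      = hLift nabla u (covDerivEndomorphism nabla J X Y u.1)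
        + vLift u (curvatureOp nabla U X (fun x ↦ J x (Y x)) u.1) := by
  rw [covDerivEndomorphism, J3_vField,
    completeLift_leviCivita_hField_hField hg hnabla hhat hX hJY hU hUu,
    completeLift_leviCivita_hField_vField hg hnabla hhat hX hY, J3_vLift, covDerivEndomorphism,
    map_sub]
  abel

theorem covDerivEndomorphism_J3_vField_hField (hg : IsPseudoRiemannianMetric g)
    (hnabla : IsLeviCivita g nabla) (hhat : IsLeviCivita (completeLift g nabla) nablaHat)
    (hX : CMDiffAt ∞ (T% X) u.1) (hY : CMDiffAt ∞ (T% Y) u.1)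
    (hJY : CMDiffAt ∞ (T% fun x ↦ J x (Y x)) u.1) :
    covDerivEndomorphism nablaHat (J3 nabla J) (vField X) (hField nabla Y) u = 0 := by
  rw [covDerivEndomorphism, J3_hField, completeLift_leviCivita_vField_vField hg hnabla hhat hX hJY,
    completeLift_leviCivita_vField_hField hg hnabla hhat hX hY, map_zero, sub_zero]

theorem covDerivEndomorphism_J3_vField_vField (hg : IsPseudoRiemannianMetric g)
    (hnabla : IsLeviCivita g nabla) (hhat : IsLeviCivita (completeLift g nabla) nablaHat)
    (hX : CMDiffAt ∞ (T% X) u.1) (hY : CMDiffAt ∞ (T% Y) u.1)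
    (hJY : CMDiffAt ∞ (T% fun x ↦ J x (Y x)) u.1) :
    covDerivEndomorphism nablaHat (J3 nabla J) (vField X) (vField Y) u = 0 := by
  rw [covDerivEndomorphism, J3_vField, completeLift_leviCivita_vField_hField hg hnabla hhat hX hJY,
    completeLift_leviCivita_vField_vField hg hnabla hhat hX hY, map_zero, sub_zero]

end LiftedStructures

theorem structureTensor_eq_apply_covDerivEndomorphism
    {E : Type*} [NormedAddCommGroup E] [NormedSpace ℝ E]
    {H : Type*} [TopologicalSpace H] {I : ModelWithCorners ℝ E H}
    {M : Type*} [TopologicalSpace M] [ChartedSpace H M] [IsManifold I 1 M]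
    (g : Π x : M, TangentSpace I x →L[ℝ] TangentSpace I x →L[ℝ] ℝ)
    (cov : CovariantDerivative I E (TangentSpace I : M → Type _))
    (J : Π x : M, TangentSpace I x →L[ℝ] TangentSpace I x)
    (X Y Z : Π x : M, TangentSpace I x) (x : M) :
    structureTensor g cov J X Y Z x = g x (covDerivEndomorphism cov J X Y x) (Z x) :=
  rfl

namespace AlmostNordenStructure

variable {E : Type*} [NormedAddCommGroup E] [NormedSpace ℝ E]
  {M : Type*} [TopologicalSpace M] [ChartedSpace E M] [IsManifold 𝓘(ℝ, E) ∞ M]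

theorem isPseudoRiemannianMetric (S : AlmostNordenStructure E M) : IsPseudoRiemannianMetric S.g :=
  ⟨S.g_symm, S.g_nondegenerate, S.g_smooth⟩

theorem g_J_left (S : AlmostNordenStructure E M) (x : M) (v w : TangentSpace 𝓘(ℝ, E) x) :
    S.g x (S.J x v) w = S.g x v (S.J x w) := by
  have h := S.norden x v (S.J x w)
  rw [S.J_sq, map_neg] at h
  linarith

end AlmostNordenStructure

theorem mainTheorem5_general {E : Type*} [NormedAddCommGroup E] [NormedSpace ℝ E]
    [FiniteDimensional ℝ E]
    {M : Type*} [TopologicalSpace M] [ChartedSpace E M] [IsManifold 𝓘(ℝ, E) ∞ M]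
    {g : Π x : M, TangentSpace 𝓘(ℝ, E) x →L[ℝ] TangentSpace 𝓘(ℝ, E) x →L[ℝ] ℝ}
    (hg : IsPseudoRiemannianMetric g)
    {J : Π x : M, TangentSpace 𝓘(ℝ, E) x →L[ℝ] TangentSpace 𝓘(ℝ, E) x}
    (hJ : ContMDiff 𝓘(ℝ, E) (𝓘(ℝ, E).prod 𝓘(ℝ, E →L[ℝ] E)) ∞
      (fun x : M ↦ TotalSpace.mk' (E →L[ℝ] E)
        (E := fun x : M ↦ TangentSpace 𝓘(ℝ, E) x →L[ℝ] TangentSpace 𝓘(ℝ, E) x) x (J x)))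
    (hgJ : ∀ (x : M) (v w : TangentSpace 𝓘(ℝ, E) x), g x (J x v) w = g x v (J x w))
    {nabla : CovariantDerivative 𝓘(ℝ, E) E (TangentSpace 𝓘(ℝ, E) : M → Type _)}
    (hnabla : IsLeviCivita g nabla)
    {nablaHat : CovariantDerivative 𝓘(ℝ, E).tangent (E × E)
      (TangentSpace 𝓘(ℝ, E).tangent : TangentBundle 𝓘(ℝ, E) M → Type _)}
    (hhat : IsLeviCivita (completeLift g nabla) nablaHat)
    {u : TangentBundle 𝓘(ℝ, E) M} {U X Y : Π x : M, TangentSpace 𝓘(ℝ, E) x}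
    (Z : Π x : M, TangentSpace 𝓘(ℝ, E) x)
    (hU : CMDiffAt ∞ (T% U) u.1) (hX : CMDiffAt ∞ (T% X) u.1) (hY : CMDiffAt ∞ (T% Y) u.1)
    (hUu : U u.1 = u.2) :
    let F := structureTensor g nabla J
    let R := curvatureForm g nabla
    let JY : Π x : M, TangentSpace 𝓘(ℝ, E) x := fun x ↦ J x (Y x)
    let JZ : Π x : M, TangentSpace 𝓘(ℝ, E) x := fun x ↦ J x (Z x)
    let gHat := completeLift g nabla
    let F₁ := structureTensor gHat nablaHat (J1 nabla J)
    let F₂ := structureTensor gHat nablaHat (J2 nabla)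
    let F₃ := structureTensor gHat nablaHat (J3 nabla J)
    let XH := hField nabla X
    let YH := hField nabla Y
    let ZH := hField nabla Z
    let XV := vField X
    let YV := vField Y
    let ZV := vField Z
    (F₁ XH YH ZH u = -R U X JY Z u.1 - R U X Y JZ u.1 ∧
      F₁ XH YH ZV u = -F X Y Z u.1 ∧
      F₁ XH YV ZH u = F X Y Z u.1 ∧
      F₁ XH YV ZV u = 0 ∧
      F₁ XV YH ZH u = 0 ∧ F₁ XV YH ZV u = 0 ∧ F₁ XV YV ZH u = 0 ∧ F₁ XV YV ZV u = 0) ∧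
    (F₂ XH YH ZH u = 0 ∧
      F₂ XH YH ZV u = R U X Y Z u.1 ∧
      F₂ XH YV ZH u = -R U X Y Z u.1 ∧
      F₂ XH YV ZV u = 0 ∧
      F₂ XV YH ZH u = 0 ∧ F₂ XV YH ZV u = 0 ∧ F₂ XV YV ZH u = 0 ∧ F₂ XV YV ZV u = 0) ∧
    (F₃ XH YH ZH u = F X Y Z u.1 ∧
      F₃ XH YH ZV u = -R U X Y JZ u.1 ∧
      F₃ XH YV ZH u = R U X JY Z u.1 ∧
      F₃ XH YV ZV u = F X Y Z u.1 ∧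
      F₃ XV YH ZH u = 0 ∧ F₃ XV YH ZV u = 0 ∧ F₃ XV YV ZH u = 0 ∧ F₃ XV YV ZV u = 0) := by
  have hJY : CMDiffAt ∞ (T% fun x ↦ J x (Y x)) u.1 :=
    ContMDiffAt.clm_bundle_apply (F₁ := E) (F₂ := E) (hJ u.1) hY
  intro F R JY JZ gHat F₁ F₂ F₃ XH YH ZH XV YV ZV
  simp only [F, R, JY, JZ, gHat, F₁, F₂, F₃, XH, YH, ZH, XV, YV, ZV,
    structureTensor_eq_apply_covDerivEndomorphism,
    covDerivEndomorphism_J1_hField_hField hg hnabla hhat hX hY hJY hU hUu,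
    covDerivEndomorphism_J1_hField_vField hg hnabla hhat hX hY hJY,
    covDerivEndomorphism_J1_vField_hField hg hnabla hhat hX hY hJY,
    covDerivEndomorphism_J1_vField_vField hg hnabla hhat hX hY hJY,
    covDerivEndomorphism_J2_hField_hField hg hnabla hhat hX hY hU hUu,
    covDerivEndomorphism_J2_hField_vField hg hnabla hhat hX hY hU hUu,
    covDerivEndomorphism_J2_vField_hField hg hnabla hhat hX hY,
    covDerivEndomorphism_J2_vField_vField hg hnabla hhat hX hY,
    covDerivEndomorphism_J3_hField_hField hg hnabla hhat hX hY hJY hU hUu,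
    covDerivEndomorphism_J3_hField_vField hg hnabla hhat hX hY hJY hU hUu,
    covDerivEndomorphism_J3_vField_hField hg hnabla hhat hX hY hJY,
    covDerivEndomorphism_J3_vField_vField hg hnabla hhat hX hY hJY]
  simp only [hField, vField, curvatureForm, map_add, map_sub, map_neg, map_zero, add_apply,
    sub_apply, neg_apply, zero_apply, completeLift_hLift_hLift, completeLift_hLift_vLift,
    completeLift_vLift_hLift, completeLift_vLift_vLift, hgJ, neg_add', neg_zero, sub_zero,
    zero_sub, add_zero, zero_add, and_self]

theorem mainTheorem5 {E : Type*} [NormedAddCommGroup E] [NormedSpace ℝ E] [FiniteDimensional ℝ E]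
    {M : Type*} [TopologicalSpace M] [ChartedSpace E M] [IsManifold 𝓘(ℝ, E) ∞ M]
    (S : AlmostNordenStructure E M)
    (nabla : CovariantDerivative 𝓘(ℝ, E) E (TangentSpace 𝓘(ℝ, E) : M → Type _))
    (hnabla : IsLeviCivita S.g nabla)
    (nablaHat : CovariantDerivative 𝓘(ℝ, E).tangent (E × E)
      (TangentSpace 𝓘(ℝ, E).tangent : TangentBundle 𝓘(ℝ, E) M → Type _))
    (hnablaHat : IsLeviCivita (completeLift S.g nabla) nablaHat)
    (u : TangentBundle 𝓘(ℝ, E) M)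
    (U X Y Z : Π x : M, TangentSpace 𝓘(ℝ, E) x)
    (hU : CMDiffAt ∞ (T% U) u.1) (hX : CMDiffAt ∞ (T% X) u.1)
    (hY : CMDiffAt ∞ (T% Y) u.1) (hZ : CMDiffAt ∞ (T% Z) u.1)
    (hUu : U u.1 = u.2) :
    let F := structureTensor S.g nabla S.J
    let R := curvatureForm S.g nabla
    let JY : Π x : M, TangentSpace 𝓘(ℝ, E) x := fun x ↦ S.J x (Y x)
    let JZ : Π x : M, TangentSpace 𝓘(ℝ, E) x := fun x ↦ S.J x (Z x)
    let gHat := completeLift S.g nabla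
    let F₁ := structureTensor gHat nablaHat (J1 nabla S.J)
    let F₂ := structureTensor gHat nablaHat (J2 nabla)
    let F₃ := structureTensor gHat nablaHat (J3 nabla S.J)
    let XH := hField nabla X
    let YH := hField nabla Y
    let ZH := hField nabla Z
    let XV := vField X
    let YV := vField Y
    let ZV := vField Z
    (F₁ XH YH ZH u = -R U X JY Z u.1 - R U X Y JZ u.1 ∧
      F₁ XH YH ZV u = -F X Y Z u.1 ∧
      F₁ XH YV ZH u = F X Y Z u.1 ∧
      F₁ XH YV ZV u = 0 ∧
      F₁ XV YH ZH u = 0 ∧ F₁ XV YH ZV u = 0 ∧ F₁ XV YV ZH u = 0 ∧ F₁ XV YV ZV u = 0) ∧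
    (F₂ XH YH ZH u = 0 ∧
      F₂ XH YH ZV u = R U X Y Z u.1 ∧
      F₂ XH YV ZH u = -R U X Y Z u.1 ∧
      F₂ XH YV ZV u = 0 ∧
      F₂ XV YH ZH u = 0 ∧ F₂ XV YH ZV u = 0 ∧ F₂ XV YV ZH u = 0 ∧ F₂ XV YV ZV u = 0) ∧
    (F₃ XH YH ZH u = F X Y Z u.1 ∧
      F₃ XH YH ZV u = -R U X Y JZ u.1 ∧
      F₃ XH YV ZH u = R U X JY Z u.1 ∧
      F₃ XH YV ZV u = F X Y Z u.1 ∧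
      F₃ XV YH ZH u = 0 ∧ F₃ XV YH ZV u = 0 ∧ F₃ XV YV ZH u = 0 ∧ F₃ XV YV ZV u = 0) :=
  mainTheorem5_general S.isPseudoRiemannianMetric S.J_smooth S.g_J_left hnabla hnablaHat Z hU hX hY
    hUu
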